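/- **Setting.** Let $\mathcal Y$ be a measurable space whose diagonal is measurable in $\mathcal Y\times\mathcal Y$ (e.g. a Polish space with its Borel $\sigma$-field), $H$ a probability measure on $\mathcal Y$, and $\theta>0$. A Gamma process $\mu_\theta$ with shape $\theta H$ is a random finite measure on $\mathcal Y$ with law $\mathcal G(d\mu\mid\theta H)$ characterized by $$E\big[e^{-\mu_\theta(g)}\big]=\exp\Big(-\int_{\mathcal Y}\log(1+g(y))\,\theta H(dy)\Big)\quad\text{for all bounded measurable } g\ge 0 .$$ A Dirichlet process $P_\theta$ with shape $\theta H$ is a random probability measure on $\mathcal Y$ such that, for each finite measurable partition $A_1,\dots,A_k$ of $\mathcal Y$, the vector $(P_\theta(A_1),\dots,P_\theta(A_k))$ has the Dirichlet distribution with parameters $\theta H(A_1),\dots,\theta H(A_k)$. For $d<\theta$, a Beta-Gamma process with parameters $(\theta H,d)$ is a random measure with law $$\frac{\Gamma(\theta)}{\Gamma(\theta-d)}\,T^{-d}\,\mathcal G(d\mu\mid\theta H),\qquad T=\mu(\mathcal Y);$$ for $q>0$ let $\mu_{\theta,\theta-q}$ denote a Beta-Gamma process with parameters $(\theta H,\theta-q)$.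 Write $U_{a,b}$ for a Beta$(a,b)$ random variable, $T_a$ for a Gamma random variable with shape $a$ and scale $1$, $Y_1$ for a random element with law $H$, and $\mathcal L(Z)$ for the law of $Z$. For an integer $n\ge 0$, let $\mathbf Y=(Y_1,\dots,Y_n)$ have the Blackwell–MacQueen distribution $$\mathbb P(d\mathbf Y\mid\theta H)=\frac{\Gamma(\theta)}{\Gamma(\theta+n)}\prod_{i=1}^n\Big(\theta H+\sum_{j=1}^{i-1}\delta_{Y_j}\Big)(dY_i),$$ let $\mathbf p=\{C_1,\dots,C_{n(\mathbf p)}\}$ be the random partition of $\{1,\dots,n\}$ in which $i,i'$ share a cell iff $Y_i=Y_{i'}$, let $e_{j,n}=|C_j|$, and let $Y_j^*$ be the common value of the $Y_i$ with $i\in C_j$. **Theorem.** Let $\theta>0$ and $q>0$. (i) For every integer $n\ge 0$ with $\theta+n-q>0$, $$\mathcal L(\mu_{\theta,\theta-q})=\mathcal L\Big(U_{q,\theta+n-q}\,\mu_\theta+U_{q,\theta+n-q}\sum_{j=1}^{n(\mathbf p)}G_{j,n}\,\delta_{Y_j^*}\Big),$$ where $\mathbf Y=(\mathbf Y^*,\mathbf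 p)$ has law $\mathbb P(d\mathbf Y\mid\theta H)$ and, conditionally on $\mathbf p$, the elements $U_{q,\theta+n-q}$, $\mu_\theta$, $\mathbf Y^*=(Y_j^*)_j$, $G_{1,n},\dots,G_{n(\mathbf p),n}$ are mutually independent, $U_{q,\theta+n-q}$ is Beta$(q,\theta+n-q)$, $\mu_\theta$ is a Gamma process with shape $\theta H$ and $G_{j,n}$ is Gamma with shape $e_{j,n}$ and scale $1$. If moreover $H$ is nonatomic, then $\mathbf p$ has the distribution $$\pi(\mathbf p\mid\theta)=\frac{\theta^{n(\mathbf p)}\Gamma(\theta)}{\Gamma(\theta+n)}\prod_{j=1}^{n(\mathbf p)}(e_{j,n}-1)!$$ and, conditionally on $\mathbf p$, the $Y_j^*$, $j=1,\dots,n(\mathbf p)$, are i.i.d. with law $H$. (ii) With $\mu_\theta$, $T_1$, $Y_1$ and the Beta variable mutually independent, $$\mathcal L(\mu_{\theta,\theta-1})=\mathcal L\big(U_{1,\theta}\,\mu_\theta+U_{1,\theta}\,T_1\,\delta_{Y_1}\big),\qquad \mathcal L(\mu_\theta)=\mathcal L\big(U_{\theta,1}\,\mu_\theta+U_{\theta,1}\,T_1\,\delta_{Y_1}\big).$$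 (iii) $\mathcal L(\mu_{\theta,\theta-q})=\mathcal L(T_q\,P_\theta)$, where $T_q$ is independent of $P_\theta$. Hence $\mathcal L(T_\theta\,\mu_{\theta,\theta-q})=\mathcal L(T_q\,\mu_\theta)$, where $T_\theta$ is independent of $\mu_{\theta,\theta-q}$ and $T_q$ is independent of $\mu_\theta$. -/

import Mathlib

open MeasureTheory ProbabilityTheory
open scoped ENNReal ProbabilityTheory

noncomputable section

/-- `𝒢` is the law of a Gamma process with finite shape measure `α`: a probability law on the
measures on `𝓨`, concentrated on finite measures, with Laplace functional
`𝔼 exp(-μ(g)) = exp(-∫ log(1 + g) dα)` for all bounded measurable `g ≥ 0`. -/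
structure IsGammaLaw {𝓨 : Type*} [MeasurableSpace 𝓨] (α : Measure 𝓨)
    (𝒢 : Measure (Measure 𝓨)) : Prop where
  isProbabilityMeasure : IsProbabilityMeasure 𝒢
  ae_finite : ∀ᵐ μ ∂𝒢, IsFiniteMeasure μ
  laplace : ∀ g : 𝓨 → ℝ, Measurable g → (∀ y, 0 ≤ g y) → (∃ C, ∀ y, g y ≤ C) →
    ∫ μ, Real.exp (-∫ y, g y ∂μ) ∂𝒢 = Real.exp (-∫ y, Real.log (1 + g y) ∂α)

/-- The Beta-Gamma law `(Γ(θ) / Γ(θ - d)) T^{-d} 𝒢(dμ)`, where `T = μ(𝓨)` and `𝒢` is the law of a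
Gamma process whose shape measure has total mass `θ`. -/
def betaGammaLaw {𝓨 : Type*} [MeasurableSpace 𝓨] (θ d : ℝ) (𝒢 : Measure (Measure 𝓨)) :
    Measure (Measure 𝓨) :=
  𝒢.withDensity fun μ =>
    ENNReal.ofReal (Real.Gamma θ / Real.Gamma (θ - d)) * (μ Set.univ) ^ (-d)

/-- The Gamma distribution with shape `a` and scale `1`, the one with shape `0` being the point
mass at `0`. -/
def gammaOrZero (a : ℝ) : Measure ℝ :=
  if a = 0 then Measure.dirac 0 else gammaMeasure a 1

/-- The Dirichlet distribution with parameters `a i ≥ 0`, not all zero: the law of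
`(Z_i / ∑ j, Z_j)_i`, where the `Z_i` are independent Gamma variables with shapes `a i`. -/
def dirichletMeasure {k : ℕ} (a : Fin k → ℝ) : Measure (Fin k → ℝ) :=
  (Measure.pi fun i => gammaOrZero (a i)).map fun z i => z i / ∑ j, z j

/-- `𝒟` is the law of a Dirichlet process with finite shape measure `α`: a random probability
measure `P` such that for each finite measurable partition `A_1, …, A_k` of `𝓨` the vector
`(P(A_1), …, P(A_k))` has the Dirichlet distribution with parameters `α(A_1), …, α(A_k)`. -/
structure IsDirichletLaw {𝓨 : Type*} [MeasurableSpace 𝓨] (α : Measure 𝓨)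
    (𝒟 : Measure (Measure 𝓨)) : Prop where
  isProbabilityMeasure : IsProbabilityMeasure 𝒟
  ae_probability : ∀ᵐ P ∂𝒟, IsProbabilityMeasure P
  marginals : ∀ (k : ℕ) (A : Fin k → Set 𝓨), (∀ i, MeasurableSet (A i)) →
    Pairwise (fun i j => Disjoint (A i) (A j)) → (⋃ i, A i) = Set.univ →
    𝒟.map (fun P i => P.real (A i)) = dirichletMeasure fun i => α.real (A i)

/-- The unnormalized measure
`α(dY_1) (α + δ_{Y_1})(dY_2) ⋯ (α + δ_{Y_1} + ⋯ + δ_{Y_{n-1}})(dY_n)` on `𝓨^n`. -/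
def urnProduct {𝓨 : Type*} [MeasurableSpace 𝓨] (α : Measure 𝓨) :
    (n : ℕ) → Measure (Fin n → 𝓨)
  | 0 => Measure.dirac Fin.elim0
  | n + 1 =>
    ((urnProduct α n) ⊗ₘ
      (Kernel.const (Fin n → 𝓨) α +
        ∑ j : Fin n, Kernel.deterministic (fun y : Fin n → 𝓨 => y j) (measurable_pi_apply j))).map
      fun p => (Fin.snoc p.1 p.2 : Fin (n + 1) → 𝓨)

/-- The Blackwell–MacQueen distribution on `𝓨^n` with parameter `θH`. -/
def blackwellMacQueen {𝓨 : Type*} [MeasurableSpace 𝓨] (θ : ℝ) (H : Measure 𝓨) (n : ℕ) :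
    Measure (Fin n → 𝓨) :=
  ENNReal.ofReal (Real.Gamma θ / Real.Gamma (θ + n)) • urnProduct (ENNReal.ofReal θ • H) n

open Classical in
/-- The partition of the index set induced by the ties of `y`: `i` and `j` lie in the same cell
iff `y i = y j`. -/
def tiePartition {𝓨 : Type*} {n : ℕ} (y : Fin n → 𝓨) :
    Finpartition (Finset.univ : Finset (Fin n)) :=
  Finpartition.ofSetoid (Setoid.ker y)

/-- The value of `y` on the cell `C` of the partition `p` (read off at the least index in `C`).
For `p = tiePartition y` these are the distinct values `Y_j^*` of `y`, one for each cell. -/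
def cellValue {𝓨 : Type*} {n : ℕ} (p : Finpartition (Finset.univ : Finset (Fin n)))
    (C : p.parts) (y : Fin n → 𝓨) : 𝓨 :=
  y (C.1.min' (p.nonempty_of_mem_parts C.2))

/-- The Ewens weight `θ^{n(p)} Γ(θ) / Γ(θ + n) ∏_{C ∈ p} (|C| - 1)!` of a partition `p`. -/
def ewensWeight (θ : ℝ) {n : ℕ} (p : Finpartition (Finset.univ : Finset (Fin n))) : ℝ :=
  θ ^ p.parts.card * Real.Gamma θ / Real.Gamma (θ + n) *
    ∏ C ∈ p.parts, ((C.card - 1).factorial : ℝ)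

end

/-! Write `μ = T P`, where `T` is the total mass and `P` the normalization. The theorem rests on the
fact that under the Gamma law with shape `θH` the mass `T` is Gamma(θ) and independent of `P`
(`IsGammaLaw.map_total_normalize`). The reason is scaling: by the Laplace functional, tilting the
law by `exp(-sT)` and normalizing amounts to multiplying `μ` by `1/(1+s)`, and `P` does not feel the
multiplication; hence `E[exp(-sT); P ∈ B] = (1+s)^(-θ) Pr(P ∈ B)` for every `s ≥ 0`. A density that
is a power of `T` therefore changes only the Gamma factor, and the Beta-Gamma law is the law of `T_q
P` (`IsGammaLaw.betaGammaLaw_eq`). Since `P` is a Dirichlet process and Dirichlet laws are unique,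
this is the first half of (iii); the second half says that `T_θ T_q P` is symmetric in the two Gamma
variables.

For (i), differentiating the Laplace functional gives a Palm formula
(`IsGammaLaw.lintegral_total_mul`): weighting a Gamma law by `T` is the same as adding to its shape
`α` a unit atom located according to `α`. The urn draws each new value from the current shape, so
`n` draws produce the weight `T^n` (`IsGammaLaw.lintegral_urnProduct`). After normalization this is
the law of `T_{θ+n} P`, and an independent Beta(q, θ+n-q) factor turns `T_{θ+n}` into `T_q`
(`lintegral_beta_blackwellMacQueen`). Atoms at equal values merge at no cost, because a Gamma law
depends only on its shape and the `n` unit atoms add up to the atoms of mass `|C|` at the distinct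
values (`atomLaw_cellValue`). Part (ii) is the case of one draw, with `q = 1` and `q = θ`.

The Ewens formula is an induction along the urn (`lintegral_urnProduct_tieSet`): when `H` has no
atoms, a draw that joins a cell of size `m` costs a factor `m`, and a draw that opens a new cell
costs `θ` and has law `H`. -/

/-! ### Laplace functionals determine laws of random measures. -/

section LaplaceUniqueness

open scoped NNReal BoundedContinuousFunction

variable {ι : Type*} [Fintype ι]

/-- The bounded continuous function `x ↦ exp (-∑ i, t i * x i)` on `ℝ≥0^ι`. -/
noncomputable def expNegBCF (t : ι → ℝ≥0) : (ι → ℝ≥0) →ᵇ ℝ :=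
  BoundedContinuousFunction.ofNormedAddCommGroup
    (fun x => Real.exp (-∑ i, (t i : ℝ) * (x i : ℝ))) (by fun_prop) 1 (by
      intro x
      rw [Real.norm_eq_abs, Real.abs_exp, Real.exp_le_one_iff, neg_nonpos]
      positivity)

@[simp]
lemma expNegBCF_apply (t x : ι → ℝ≥0) :
    expNegBCF t x = Real.exp (-∑ i, (t i : ℝ) * (x i : ℝ)) := rfl

/-- The functions `expNegBCF t` form a submonoid of the bounded continuous functions. -/
noncomputable def expNegSubmonoid (ι : Type*) [Fintype ι] : Submonoid ((ι → ℝ≥0) →ᵇ ℝ) where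
  carrier := Set.range expNegBCF
  one_mem' := ⟨0, by ext x; simp⟩
  mul_mem' := by
    rintro _ _ ⟨s, rfl⟩ ⟨t, rfl⟩
    refine ⟨s + t, ?_⟩
    ext x
    simp [add_mul, Finset.sum_add_distrib, ← Real.exp_add]
    ring_nf

/-- The star subalgebra spanned by the functions `expNegBCF t`. -/
noncomputable def expNegSubalgebra (ι : Type*) [Fintype ι] :
    StarSubalgebra ℝ ((ι → ℝ≥0) →ᵇ ℝ) where
  toSubalgebra := Algebra.adjoin ℝ (expNegSubmonoid ι : Set ((ι → ℝ≥0) →ᵇ ℝ))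
  star_mem' := by
    intro a ha
    have : star a = a := by ext x; simp
    rwa [this]

/-- Finite measures on `ℝ≥0^ι` are determined by their Laplace transforms. -/
theorem Measure.ext_of_laplace_nnreal {ρ σ : Measure (ι → ℝ≥0)} [IsFiniteMeasure ρ]
    [IsFiniteMeasure σ]
    (h : ∀ t : ι → ℝ≥0, ∫ x, Real.exp (-∑ i, (t i : ℝ) * (x i : ℝ)) ∂ρ =
      ∫ x, Real.exp (-∑ i, (t i : ℝ) * (x i : ℝ)) ∂σ) : ρ = σ := by
  classical
  -- An algebra of bounded continuous functions that separates points determines finite measures on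
  -- a Polish space. The exponentials are closed under products, so the algebra they generate is
  -- their linear span, and equality of integrals extends to it by linearity.
  refine ext_of_forall_mem_subalgebra_integral_eq_of_polish (𝕜 := ℝ) (A := expNegSubalgebra ι)
    ?_ ?_
  · intro x y hxy
    obtain ⟨i, hi⟩ := Function.ne_iff.1 hxy
    refine ⟨_, ⟨(expNegBCF (Pi.single i 1)).toContinuousMap,
      ⟨expNegBCF (Pi.single i 1), Algebra.subset_adjoin ⟨_, rfl⟩, rfl⟩, rfl⟩, ?_⟩
    simpa [Pi.single_apply, apply_ite NNReal.toReal] using hi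
  · intro g hg
    have hg' : g ∈ Submodule.span ℝ (expNegSubmonoid ι : Set ((ι → ℝ≥0) →ᵇ ℝ)) := by
      have h1 : g ∈ Subalgebra.toSubmodule
        (Algebra.adjoin ℝ (expNegSubmonoid ι : Set ((ι → ℝ≥0) →ᵇ ℝ))) := hg
      rwa [Algebra.adjoin_eq_span, Submonoid.closure_eq] at h1
    clear hg
    induction hg' using Submodule.span_induction with
    | mem x hx =>
      obtain ⟨t, rfl⟩ := hx
      exact h t
    | zero => simp
    | add x y _ _ hx hy =>
      have e : ∀ (τ : Measure (ι → ℝ≥0)) [IsFiniteMeasure τ],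
          ∫ z, (x + y) z ∂τ = ∫ z, x z ∂τ + ∫ z, y z ∂τ := fun τ _ => by
        simp only [BoundedContinuousFunction.coe_add, Pi.add_apply]
        exact integral_add (x.integrable τ) (y.integrable τ)
      rw [e, e, hx, hy]
    | smul a x _ hx =>
      simp only [BoundedContinuousFunction.coe_smul, integral_smul]
      rw [hx]

/-- Finite measures on `ℝ^ι` concentrated on the positive orthant are determined by their Laplace
transforms. -/
theorem Measure.ext_of_laplace_real {ρ σ : Measure (ι → ℝ)} [IsFiniteMeasure ρ]
    [IsFiniteMeasure σ] (hρ : ∀ᵐ x ∂ρ, ∀ i, 0 ≤ x i) (hσ : ∀ᵐ x ∂σ, ∀ i, 0 ≤ x i)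
    (h : ∀ t : ι → ℝ≥0, ∫ x, Real.exp (-∑ i, (t i : ℝ) * x i) ∂ρ =
      ∫ x, Real.exp (-∑ i, (t i : ℝ) * x i) ∂σ) : ρ = σ := by
  have hm : Measurable fun (x : ι → ℝ) i => (x i).toNNReal := by fun_prop
  have hc : Measurable fun (x : ι → ℝ≥0) i => (x i : ℝ) := by fun_prop
  have key : ∀ {τ : Measure (ι → ℝ)}, (∀ᵐ x ∂τ, ∀ i, 0 ≤ x i) →
      (τ.map fun x i => (x i).toNNReal).map (fun x i => (x i : ℝ)) = τ := by
    intro τ hτ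
    rw [Measure.map_map hc hm]
    conv_rhs => rw [← Measure.map_id (μ := τ)]
    refine Measure.map_congr ?_
    filter_upwards [hτ] with x hx
    funext i
    simp [hx i]
  have key2 : ∀ {τ : Measure (ι → ℝ)}, (∀ᵐ x ∂τ, ∀ i, 0 ≤ x i) → ∀ t : ι → ℝ≥0,
      ∫ x, Real.exp (-∑ i, (t i : ℝ) * (x i : ℝ)) ∂(τ.map fun x i => (x i).toNNReal) =
      ∫ x, Real.exp (-∑ i, (t i : ℝ) * x i) ∂τ := by
    intro τ hτ t
    refine (integral_map hm.aemeasurable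
      (expNegBCF t).continuous.aestronglyMeasurable).trans ?_
    simp only [expNegBCF_apply]
    refine integral_congr_ae ?_
    filter_upwards [hτ] with x hx
    simp [hx]
  rw [← key hρ, ← key hσ]
  congr 1
  refine Measure.ext_of_laplace_nnreal fun t => ?_
  rw [key2 hρ, key2 hσ, h]

variable {𝓨 : Type*} [MeasurableSpace 𝓨]

/-- Finite measures on the measures on `𝓨` are determined by the joint laws of the evaluations at
finitely many measurable sets. -/
theorem Measure.ext_of_evaluations {ρ σ : Measure (Measure 𝓨)} [IsFiniteMeasure ρ]
    [IsFiniteMeasure σ]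
    (h : ∀ I : Finset {A : Set 𝓨 // MeasurableSet A},
      ρ.map (fun μ (A : I) => μ A.1.1) = σ.map (fun μ (A : I) => μ A.1.1)) : ρ = σ := by
  let E : Measure 𝓨 → ({A : Set 𝓨 // MeasurableSet A} → ℝ≥0∞) := fun μ A => μ A.1
  have hE : Measurable E := measurable_pi_lambda _ fun A => Measure.measurable_coe A.2
  have hEI : ∀ I : Finset {A : Set 𝓨 // MeasurableSet A}, ∀ τ : Measure (Measure 𝓨),
      (τ.map E).map I.restrict = τ.map (fun μ (A : I) => μ A.1.1) := fun I τ => by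
    rw [Measure.map_map (by fun_prop) hE]; rfl
  have hmap : ρ.map E = σ.map E := by
    refine IsProjectiveLimit.unique (P := fun I => ρ.map (fun μ (A : I) => μ A.1.1)) ?_ ?_
    · intro I; exact hEI I ρ
    · intro I; rw [hEI I σ, ← h I]
  -- The σ-field on measures is generated by the evaluations, so every event is pulled back along
  -- `E` and it suffices to compare the images under `E`.
  have hle : (Measure.instMeasurableSpace : MeasurableSpace (Measure 𝓨)) ≤
      MeasurableSpace.comap E inferInstance := by
    refine iSup₂_le fun s hs => ?_
    rw [MeasurableSpace.comap_le_iff_le_map]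
    intro B hB
    exact ⟨(fun f => f ⟨s, hs⟩) ⁻¹' B, (measurable_pi_apply _) (by
      rwa [← BorelSpace.measurable_eq (α := ℝ≥0∞)] at hB), rfl⟩
  ext B hB
  obtain ⟨C, hC, rfl⟩ := hle B hB
  rw [← Measure.map_apply hE hC, hmap, Measure.map_apply hE hC]

lemma SimpleFunc.sum_apply {κ : Type*} (s : Finset κ) (f : κ → SimpleFunc 𝓨 ℝ≥0) (y : 𝓨) :
    (∑ i ∈ s, f i) y = ∑ i ∈ s, f i y := by
  classical
  induction s using Finset.induction_on with
  | empty => simp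
  | insert a s ha ih => simp [Finset.sum_insert ha, ih]

/-- Two finite laws of random finite measures agree if their Laplace functionals agree on
nonnegative simple functions. -/
theorem Measure.ext_of_laplaceFunctional {ρ σ : Measure (Measure 𝓨)} [IsFiniteMeasure ρ]
    [IsFiniteMeasure σ] (hρ : ∀ᵐ μ ∂ρ, IsFiniteMeasure μ) (hσ : ∀ᵐ μ ∂σ, IsFiniteMeasure μ)
    (h : ∀ g : SimpleFunc 𝓨 ℝ≥0, ∫ μ, Real.exp (-∫ y, (g y : ℝ) ∂μ) ∂ρ =
      ∫ μ, Real.exp (-∫ y, (g y : ℝ) ∂μ) ∂σ) : ρ = σ := by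
  classical
  refine Measure.ext_of_evaluations fun I => ?_
  have hN : Measurable fun (μ : Measure 𝓨) (A : I) => (μ A.1.1).toNNReal :=
    measurable_pi_lambda _ fun A => (Measure.measurable_coe A.1.2).ennreal_toNNReal
  have key : ∀ {τ : Measure (Measure 𝓨)}, (∀ᵐ μ ∂τ, IsFiniteMeasure μ) →
      (τ.map fun μ (A : I) => (μ A.1.1).toNNReal).map (fun x A => (x A : ℝ≥0∞)) =
        τ.map (fun μ (A : I) => μ A.1.1) := by
    intro τ hτ
    rw [Measure.map_map (by fun_prop) hN]
    refine Measure.map_congr ?_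
    filter_upwards [hτ] with μ hμ
    funext A
    simp
  -- The Laplace transform of the vector of evaluations at `t` is the Laplace functional at the
  -- simple function `∑ t_A 1_A`; the sets `A` may overlap.
  have key2 : ∀ {τ : Measure (Measure 𝓨)}, (∀ᵐ μ ∂τ, IsFiniteMeasure μ) → ∀ t : I → ℝ≥0,
      ∫ x, Real.exp (-∑ i, (t i : ℝ) * (x i : ℝ))
        ∂(τ.map fun μ (A : I) => (μ A.1.1).toNNReal) =
      ∫ μ, Real.exp (-∫ y, ((∑ A : I, SimpleFunc.piecewise A.1.1 A.1.2
        (SimpleFunc.const 𝓨 (t A)) 0 : SimpleFunc 𝓨 ℝ≥0) y : ℝ) ∂μ) ∂τ := by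
    intro τ hτ t
    refine (integral_map hN.aemeasurable
      (expNegBCF t).continuous.aestronglyMeasurable).trans ?_
    simp only [expNegBCF_apply]
    refine integral_congr_ae ?_
    filter_upwards [hτ] with μ hμ
    congr 2
    have e : ∀ y, ((∑ A : I, SimpleFunc.piecewise A.1.1 A.1.2
        (SimpleFunc.const 𝓨 (t A)) 0 : SimpleFunc 𝓨 ℝ≥0) y : ℝ) =
        ∑ A : I, A.1.1.indicator (fun _ => (t A : ℝ)) y := by
      intro y
      rw [SimpleFunc.sum_apply, NNReal.coe_sum]
      refine Finset.sum_congr rfl fun A _ => ?_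
      by_cases hy : y ∈ A.1.1 <;> simp [hy]
    simp_rw [e]
    rw [integral_finsetSum _ fun A _ => (integrable_const _).indicator A.1.2]
    refine Finset.sum_congr rfl fun A _ => ?_
    rw [integral_indicator_const _ A.1.2, smul_eq_mul, mul_comm]
    rfl
  rw [← key hρ, ← key hσ]
  congr 1
  refine Measure.ext_of_laplace_nnreal fun t => ?_
  rw [key2 hρ, key2 hσ, h]

end LaplaceUniqueness

/-! ### Gamma and Beta distributions on the line. -/

section GammaBeta

lemma ae_gammaMeasure_pos (a r : ℝ) : ∀ᵐ x ∂gammaMeasure a r, 0 < x := by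
  rw [gammaMeasure, ae_withDensity_iff (f := gammaPDF a r)
    (by unfold gammaPDF; fun_prop)]
  have h0 : ∀ᵐ x : ℝ ∂volume, x ≠ 0 := by simp [ae_iff]
  filter_upwards [h0] with x hx h
  by_contra hneg
  exact h (gammaPDF_of_neg (lt_of_le_of_ne (not_lt.1 hneg) hx))

lemma lintegral_gammaMeasure (a r : ℝ) {F : ℝ → ℝ≥0∞} (hF : Measurable F) :
    ∫⁻ x, F x ∂gammaMeasure a r = ∫⁻ x, gammaPDF a r x * F x := by
  rw [gammaMeasure, lintegral_withDensity_eq_lintegral_mul _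
    (by unfold gammaPDF; fun_prop) hF]
  rfl

/-- Multiplied by `exp(-s x)`, the Gamma density of rate 1 becomes `(1+s)^(-a)` times the Gamma
density of rate `1+s`, which has integral one. -/
lemma lintegral_exp_neg_gammaMeasure {a s : ℝ} (ha : 0 < a) (hs : 0 ≤ s) :
    ∫⁻ x, ENNReal.ofReal (Real.exp (-(s * x))) ∂gammaMeasure a 1 =
      ENNReal.ofReal ((1 + s) ^ (-a)) := by
  have h1 : 0 < 1 + s := by linarith
  rw [lintegral_gammaMeasure _ _ (by fun_prop)]
  have e : ∀ x, gammaPDF a 1 x * ENNReal.ofReal (Real.exp (-(s * x))) =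
      ENNReal.ofReal ((1 + s) ^ (-a)) * gammaPDF a (1 + s) x := by
    intro x
    rcases lt_or_ge x 0 with hx | hx
    · simp [gammaPDF_of_neg hx]
    · have hG := Real.Gamma_pos_of_pos ha
      rw [gammaPDF_of_nonneg hx, gammaPDF_of_nonneg hx, ← ENNReal.ofReal_mul (by positivity),
        ← ENNReal.ofReal_mul (by positivity)]
      congr 1
      have e1 : Real.exp (-((1 + s) * x)) = Real.exp (-(1 * x)) * Real.exp (-(s * x)) := by
        rw [← Real.exp_add]; ring_nf
      have e2 : (1 + s) ^ (-a) * (1 + s) ^ a = 1 := by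
        rw [← Real.rpow_add h1]; simp
      rw [e1, Real.one_rpow]
      linear_combination (-(1 / Real.Gamma a * x ^ (a - 1) * Real.exp (-(1 * x)) *
        Real.exp (-(s * x)))) * e2
  simp_rw [e]
  rw [lintegral_const_mul _ (by unfold gammaPDF; fun_prop), lintegral_gammaPDF_eq_one ha h1,
    mul_one]

lemma integral_exp_neg_gammaMeasure {a s : ℝ} (ha : 0 < a) (hs : 0 ≤ s) :
    ∫ x, Real.exp (-(s * x)) ∂gammaMeasure a 1 = (1 + s) ^ (-a) := by
  rw [integral_eq_lintegral_of_nonneg_ae (ae_of_all _ fun x => (Real.exp_pos _).le)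
    (by fun_prop), lintegral_exp_neg_gammaMeasure ha hs, ENNReal.toReal_ofReal (by positivity)]

lemma isProbabilityMeasure_gammaOrZero {a : ℝ} (ha : 0 ≤ a) :
    IsProbabilityMeasure (gammaOrZero a) := by
  unfold gammaOrZero
  split_ifs with h
  · infer_instance
  · exact isProbabilityMeasure_gammaMeasure (lt_of_le_of_ne ha (Ne.symm h)) one_pos

lemma ae_gammaOrZero_nonneg (a : ℝ) : ∀ᵐ x ∂gammaOrZero a, 0 ≤ x := by
  unfold gammaOrZero
  split_ifs with h
  · simp
  · exact (ae_gammaMeasure_pos a 1).mono fun x hx => hx.le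

/-- The point mass at `0` obeys the same formula with exponent zero, so partition cells of shape
mass zero need no separate treatment. -/
lemma integral_exp_neg_gammaOrZero {a s : ℝ} (ha : 0 ≤ a) (hs : 0 ≤ s) :
    ∫ x, Real.exp (-(s * x)) ∂gammaOrZero a = (1 + s) ^ (-a) := by
  unfold gammaOrZero
  split_ifs with h
  · simp [h]
  · exact integral_exp_neg_gammaMeasure (lt_of_le_of_ne ha (Ne.symm h)) hs

/-- Reweighting the Gamma distribution by a power changes its shape. -/
lemma lintegral_rpow_mul_gammaMeasure {a b : ℝ} (ha : 0 < a) (hb : 0 < b) {F : ℝ → ℝ≥0∞}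
    (hF : Measurable F) :
    ∫⁻ t, ENNReal.ofReal (Real.Gamma a / Real.Gamma b) * ENNReal.ofReal t ^ (b - a) * F t
      ∂gammaMeasure a 1 = ∫⁻ t, F t ∂gammaMeasure b 1 := by
  rw [lintegral_gammaMeasure _ _ (by fun_prop), lintegral_gammaMeasure _ _ hF]
  have h0 : ∀ᵐ x : ℝ ∂volume, x ≠ 0 := by simp [ae_iff]
  refine lintegral_congr_ae ?_
  filter_upwards [h0] with x hx
  rcases lt_or_gt_of_ne hx with hx | hx
  · simp [gammaPDF_of_neg hx]
  · have hGa := Real.Gamma_pos_of_pos ha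
    have hGb := Real.Gamma_pos_of_pos hb
    rw [gammaPDF_of_nonneg hx.le, gammaPDF_of_nonneg hx.le, ENNReal.ofReal_rpow_of_pos hx,
      ← mul_assoc, ← ENNReal.ofReal_mul (by positivity), ← ENNReal.ofReal_mul (by positivity)]
    congr 2
    have e : x ^ (b - 1) = x ^ (a - 1) * x ^ (b - a) := by
      rw [← Real.rpow_add hx]; ring_nf
    rw [e, Real.one_rpow, Real.one_rpow]
    field_simp

/-- The power weight `x ^ (a - 1)` on the positive half line. -/
noncomputable def powWeight (a x : ℝ) : ℝ≥0∞ :=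
  if 0 < x then ENNReal.ofReal (x ^ (a - 1)) else 0

@[fun_prop]
lemma measurable_powWeight (a : ℝ) : Measurable (powWeight a) :=
  Measurable.ite measurableSet_Ioi (by fun_prop) measurable_const

/-- Homogeneity in this form carries the substitution `x = t u` in the Beta-Gamma product; extending
the power by zero spares all restrictions of the domain. -/
lemma powWeight_mul (a x : ℝ) {t : ℝ} (ht : 0 < t) :
    powWeight a (t * x) = ENNReal.ofReal (t ^ (a - 1)) * powWeight a x := by
  unfold powWeight
  by_cases hx : 0 < x
  · rw [if_pos hx, if_pos (mul_pos ht hx), Real.mul_rpow ht.le hx.le,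
      ENNReal.ofReal_mul (by positivity)]
  · rw [if_neg hx, if_neg (by rwa [mul_pos_iff_of_pos_left ht]), mul_zero]

/-- The two sides may differ at `0`, where `powWeight` vanishes while the density follows its
formula for `0 ≤ x`. -/
lemma gammaPDF_ae_eq {a : ℝ} (ha : 0 < a) : ∀ᵐ x ∂(volume : Measure ℝ), gammaPDF a 1 x =
    ENNReal.ofReal (Real.Gamma a)⁻¹ * (powWeight a x * ENNReal.ofReal (Real.exp (-x))) := by
  have h0 : ∀ᵐ x : ℝ ∂volume, x ≠ 0 := by simp [ae_iff]
  have hGa := Real.Gamma_pos_of_pos ha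
  filter_upwards [h0] with x hx
  rcases lt_or_gt_of_ne hx with hx | hx
  · simp [gammaPDF_of_neg hx, powWeight, not_lt.2 hx.le]
  · rw [gammaPDF_of_nonneg hx.le, powWeight, if_pos hx, ← ENNReal.ofReal_mul (by positivity),
      ← ENNReal.ofReal_mul (by positivity), Real.one_rpow]
    congr 1
    rw [one_mul]; ring

lemma betaPDF_eq_powWeight {a b : ℝ} (ha : 0 < a) (hb : 0 < b) (x : ℝ) : betaPDF a b x =
    ENNReal.ofReal (beta a b)⁻¹ * (powWeight a x * powWeight b (1 - x)) := by
  have := beta_pos ha hb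
  by_cases h : 0 < x ∧ x < 1
  · have h1 : 0 < 1 - x := by linarith [h.2]
    have := h.1
    rw [betaPDF_of_pos_lt_one h.1 h.2, powWeight, powWeight, if_pos h.1, if_pos h1,
      ← ENNReal.ofReal_mul (by positivity), ← ENNReal.ofReal_mul (by positivity)]
    congr 1
    ring
  · rw [betaPDF_eq, if_neg h]
    unfold powWeight
    rcases not_and_or.1 h with h | h
    · simp [h]
    · simp [h]

lemma lintegral_eq_lintegral_mul_left {t : ℝ} (ht : 0 < t) {F : ℝ → ℝ≥0∞} (hF : Measurable F) :
    ∫⁻ x, F x = ENNReal.ofReal t * ∫⁻ u, F (t * u) := by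
  conv_lhs => rw [← Real.smul_map_volume_mul_left ht.ne']
  rw [lintegral_smul_measure, lintegral_map hF (by fun_prop), abs_of_pos ht, smul_eq_mul]

/-- The product of independent `Beta(a, b)` and `Gamma(a + b)` variables is `Gamma(a)`. -/
theorem lintegral_betaMeasure_gammaMeasure {a b : ℝ} (ha : 0 < a) (hb : 0 < b) {F : ℝ → ℝ≥0∞}
    (hF : Measurable F) :
    ∫⁻ u, ∫⁻ t, F (u * t) ∂gammaMeasure (a + b) 1 ∂betaMeasure a b =
      ∫⁻ x, F x ∂gammaMeasure a 1 := by
  have hGa := Real.Gamma_pos_of_pos ha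
  have hGb := Real.Gamma_pos_of_pos hb
  have hGab := Real.Gamma_pos_of_pos (add_pos ha hb)
  set c : ℝ≥0∞ := ENNReal.ofReal (Real.Gamma a)⁻¹ * ENNReal.ofReal (Real.Gamma b)⁻¹ with hc
  -- The constants on the two sides agree because `B(a,b) Γ(a+b) = Γ(a) Γ(b)`.
  have hc' : ENNReal.ofReal (beta a b)⁻¹ * ENNReal.ofReal (Real.Gamma (a + b))⁻¹ = c := by
    rw [hc, ← ENNReal.ofReal_mul (by have := beta_pos ha hb; positivity),
      ← ENNReal.ofReal_mul (by positivity), beta]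
    congr 1
    field_simp
  -- Inserting an independent Gamma(b) variable `y` makes the right side a double integral too. The
  -- two sides then match under `t = x + y`, `u = x / (x + y)`.
  have hone : ∫⁻ y, ENNReal.ofReal (Real.Gamma b)⁻¹ *
      (powWeight b y * ENNReal.ofReal (Real.exp (-y))) = 1 := by
    rw [← lintegral_gammaPDF_eq_one hb one_pos]
    exact (lintegral_congr_ae (gammaPDF_ae_eq hb)).symm
  have hL : ∫⁻ u, ∫⁻ t, F (u * t) ∂gammaMeasure (a + b) 1 ∂betaMeasure a b =
      ∫⁻ u, ∫⁻ t, c * (powWeight a u * powWeight b (1 - u) * powWeight (a + b) t *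
        ENNReal.ofReal (Real.exp (-t)) * F (u * t)) := by
    rw [betaMeasure, lintegral_withDensity_eq_lintegral_mul_non_measurable _
      (by unfold betaPDF; fun_prop)]
    · refine lintegral_congr fun u => ?_
      rw [Pi.mul_apply, lintegral_gammaMeasure _ _ (by fun_prop),
        ← lintegral_const_mul _ (by unfold gammaPDF; fun_prop)]
      refine lintegral_congr_ae ?_
      filter_upwards [gammaPDF_ae_eq (add_pos ha hb)] with t ht
      rw [ht, betaPDF_eq_powWeight ha hb, ← hc']
      ring
    · exact ae_of_all _ fun x => ENNReal.ofReal_lt_top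
  have hR : ∫⁻ x, F x ∂gammaMeasure a 1 =
      ∫⁻ x, ∫⁻ y, c * (powWeight a x * powWeight b y *
        ENNReal.ofReal (Real.exp (-(x + y))) * F x) := by
    rw [lintegral_gammaMeasure _ _ hF]
    refine lintegral_congr_ae ?_
    filter_upwards [gammaPDF_ae_eq ha] with x hx
    rw [hx, ← mul_one (_ * F x), ← hone, ← lintegral_const_mul _ (by fun_prop)]
    refine lintegral_congr fun y => ?_
    rw [neg_add, Real.exp_add, ENNReal.ofReal_mul (Real.exp_pos _).le, hc]
    ring
  rw [hL, hR]
  have hR2 : ∀ x, ∫⁻ y, c * (powWeight a x * powWeight b y *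
        ENNReal.ofReal (Real.exp (-(x + y))) * F x) =
      ∫⁻ t, c * (powWeight a x * powWeight b (t - x) *
        ENNReal.ofReal (Real.exp (-t)) * F x) := by
    intro x
    rw [← lintegral_sub_right_eq_self _ x]
    simp
  simp_rw [hR2]
  conv_lhs => rw [lintegral_lintegral_swap (by fun_prop)]
  conv_rhs => rw [lintegral_lintegral_swap (by fun_prop)]
  refine lintegral_congr fun t => ?_
  -- With the sum `t` outermost, nothing is left for `t ≤ 0`, since `x` and `t - x` cannot both be
  -- positive; for `t > 0` the inner substitution is `x = t u`.
  rcases le_or_gt t 0 with ht | ht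
  · have h1 : ∀ x, powWeight a x * powWeight b (t - x) = 0 := by
      intro x
      unfold powWeight
      by_cases hx : 0 < x
      · rw [if_neg (c := 0 < t - x) (by linarith), mul_zero]
      · rw [if_neg hx, zero_mul]
    have h2 : powWeight (a + b) t = 0 := if_neg (not_lt.2 ht)
    simp only [h1, h2]
    simp
  · conv_rhs => rw [lintegral_eq_lintegral_mul_left ht (by fun_prop),
      ← lintegral_const_mul _ (by fun_prop)]
    refine lintegral_congr fun u => ?_
    rw [show t - t * u = t * (1 - u) by ring, powWeight_mul _ _ ht, powWeight_mul _ _ ht,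
      show powWeight (a + b) t = ENNReal.ofReal (t ^ (a + b - 1)) from if_pos ht, mul_comm u t]
    -- The exponent splits as `1 + (a-1) + (b-1)`: the Jacobian and the two homogeneity factors.
    have e : ENNReal.ofReal (t ^ (a + b - 1)) = ENNReal.ofReal t * ENNReal.ofReal (t ^ (a - 1)) *
        ENNReal.ofReal (t ^ (b - 1)) := by
      rw [← ENNReal.ofReal_mul ht.le, ← ENNReal.ofReal_mul (by positivity)]
      congr 1
      have h := Real.rpow_one t
      conv_rhs => rw [← h, Real.rpow_one]
      nth_rewrite 2 [← Real.rpow_one t]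
      rw [← Real.rpow_add ht, ← Real.rpow_add ht]
      ring_nf
    rw [e]
    ring

end GammaBeta

/-! ### Polar decomposition of the Gamma process and the Beta-Gamma law. -/

section RandomMeasures

open scoped NNReal

variable {𝓨 : Type*} [MeasurableSpace 𝓨]

lemma measurable_smul_measure :
    Measurable fun p : ℝ≥0∞ × Measure 𝓨 => p.1 • p.2 := by
  refine Measure.measurable_of_measurable_coe _ fun s hs => ?_
  simp only [Measure.smul_apply, smul_eq_mul]
  exact measurable_fst.mul ((Measure.measurable_coe hs).comp measurable_snd)

lemma measurable_const_smul_measure (c : ℝ≥0∞) : Measurable fun μ : Measure 𝓨 => c • μ :=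
  measurable_smul_measure.comp (measurable_const.prodMk measurable_id)

lemma measurable_ofReal_smul_measure :
    Measurable fun p : ℝ × Measure 𝓨 => ENNReal.ofReal p.1 • p.2 :=
  measurable_smul_measure.comp ((ENNReal.measurable_ofReal.comp measurable_fst).prodMk
    measurable_snd)

lemma measurable_measureReal {s : Set 𝓨} (hs : MeasurableSet s) :
    Measurable fun μ : Measure 𝓨 => μ.real s :=
  (Measure.measurable_coe hs).ennreal_toReal

lemma measurable_integral_measure {g : 𝓨 → ℝ} (hg : Measurable g) (h0 : ∀ y, 0 ≤ g y) :
    Measurable fun μ : Measure 𝓨 => ∫ y, g y ∂μ := by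
  have e : (fun μ : Measure 𝓨 => ∫ y, g y ∂μ) =
      fun μ => (∫⁻ y, ENNReal.ofReal (g y) ∂μ).toReal := by
    funext μ
    exact integral_eq_lintegral_of_nonneg_ae (ae_of_all _ h0) hg.aestronglyMeasurable
  rw [e]
  exact (Measure.measurable_lintegral (by fun_prop)).ennreal_toReal

lemma measurable_exp_neg_integral {g : 𝓨 → ℝ} (hg : Measurable g) (h0 : ∀ y, 0 ≤ g y) :
    Measurable fun μ : Measure 𝓨 => Real.exp (-∫ y, g y ∂μ) := by
  have := measurable_integral_measure hg h0
  fun_prop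

lemma measurableSet_isFiniteMeasure : MeasurableSet {μ : Measure 𝓨 | IsFiniteMeasure μ} := by
  have e : {μ : Measure 𝓨 | IsFiniteMeasure μ} = (fun μ => μ Set.univ) ⁻¹' Set.Iio ⊤ := by
    ext μ
    exact isFiniteMeasure_iff μ
  rw [e]
  exact Measure.measurable_coe MeasurableSet.univ measurableSet_Iio

/-- The normalization `μ / μ(𝓨)` of a measure. -/
noncomputable def normalizeMeasure (μ : Measure 𝓨) : Measure 𝓨 := (μ Set.univ)⁻¹ • μ

lemma measurable_normalizeMeasure : Measurable (normalizeMeasure (𝓨 := 𝓨)) :=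
  measurable_smul_measure.comp
    ((Measure.measurable_coe MeasurableSet.univ).inv.prodMk measurable_id)

/-- This invariance is what makes the total mass and the normalization independent under a Gamma
law. -/
lemma normalizeMeasure_smul {c : ℝ≥0∞} (h0 : c ≠ 0) (ht : c ≠ ⊤) (μ : Measure 𝓨) :
    normalizeMeasure (c • μ) = normalizeMeasure μ := by
  unfold normalizeMeasure
  rw [Measure.smul_apply, smul_eq_mul, ENNReal.mul_inv (Or.inl h0) (Or.inl ht), smul_smul,
    mul_comm c⁻¹, mul_assoc, ENNReal.inv_mul_cancel h0 ht, mul_one]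

/-- Recovering `μ` from its polar coordinates needs only finiteness: for `μ = 0` both sides vanish.
-/
lemma smul_normalizeMeasure (μ : Measure 𝓨) [IsFiniteMeasure μ] :
    ENNReal.ofReal (μ.real Set.univ) • normalizeMeasure μ = μ := by
  unfold normalizeMeasure
  by_cases h : μ = 0
  · simp [h]
  · rw [ofReal_measureReal, smul_smul, ENNReal.mul_inv_cancel (by simpa using h) (by simp),
      one_smul]

lemma normalizeMeasure_real (μ : Measure 𝓨) (s : Set 𝓨) :
    (normalizeMeasure μ).real s = μ.real s / μ.real Set.univ := by
  simp [normalizeMeasure, Measure.real, div_eq_inv_mul]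

lemma Measure.ext_of_laplace_real_one {ρ σ : Measure ℝ} [IsFiniteMeasure ρ] [IsFiniteMeasure σ]
    (hρ : ∀ᵐ x ∂ρ, 0 ≤ x) (hσ : ∀ᵐ x ∂σ, 0 ≤ x)
    (h : ∀ s : ℝ, 0 ≤ s → ∫ x, Real.exp (-(s * x)) ∂ρ = ∫ x, Real.exp (-(s * x)) ∂σ) :
    ρ = σ := by
  have hm : Measurable fun (x : ℝ) (_ : Unit) => x := by fun_prop
  have hm' : Measurable fun (x : Unit → ℝ) => x () := by fun_prop
  have e : ρ.map (fun x (_ : Unit) => x) = σ.map (fun x (_ : Unit) => x) := by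
    refine Measure.ext_of_laplace_real ?_ ?_ fun t => ?_
    · rw [ae_map_iff hm.aemeasurable (by measurability)]
      simpa using hρ
    · rw [ae_map_iff hm.aemeasurable (by measurability)]
      simpa using hσ
    · rw [integral_map hm.aemeasurable (Measurable.aestronglyMeasurable (by fun_prop)),
        integral_map hm.aemeasurable (Measurable.aestronglyMeasurable (by fun_prop))]
      simpa using h (t ()) (t ()).2
  have e2 := congrArg (fun τ => Measure.map (fun (x : Unit → ℝ) => x ()) τ) e
  simp only [Measure.map_map hm' hm] at e2
  simpa [Function.comp_def] using e2

lemma integrable_log_one_add {α : Measure 𝓨} [IsFiniteMeasure α] {g : 𝓨 → ℝ}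
    (hg : Measurable g) (h0 : ∀ y, 0 ≤ g y) (hC : ∃ C, ∀ y, g y ≤ C) :
    Integrable (fun y => Real.log (1 + g y)) α := by
  obtain ⟨C, hC⟩ := hC
  refine Integrable.of_bound (Measurable.aestronglyMeasurable (by fun_prop)) C (ae_of_all _ fun y => ?_)
  have h1 := h0 y
  rw [Real.norm_eq_abs, abs_of_nonneg (Real.log_nonneg (by linarith))]
  have := Real.log_le_sub_one_of_pos (x := 1 + g y) (by linarith)
  linarith [hC y]

lemma integrable_of_measurable_nonneg_bounded {μ : Measure 𝓨} [IsFiniteMeasure μ] {g : 𝓨 → ℝ}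
    (hg : Measurable g) (h0 : ∀ y, 0 ≤ g y) (hC : ∃ C, ∀ y, g y ≤ C) : Integrable g μ := by
  obtain ⟨C, hC⟩ := hC
  refine Integrable.of_bound (Measurable.aestronglyMeasurable (by fun_prop)) C (ae_of_all _ fun y => ?_)
  rw [Real.norm_eq_abs, abs_of_nonneg (h0 y)]
  exact hC y

lemma SimpleFunc.bddAbove_nnreal (g : SimpleFunc 𝓨 ℝ≥0) : ∃ C : ℝ, ∀ y, (g y : ℝ) ≤ C := by
  obtain ⟨C, hC⟩ := g.finite_range.bddAbove
  exact ⟨C, fun y => NNReal.coe_le_coe.2 (hC ⟨y, rfl⟩)⟩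

lemma betaGammaLaw_zero (𝒢 : Measure (Measure 𝓨)) {θ : ℝ} (hθ : 0 < θ) :
    betaGammaLaw θ 0 𝒢 = 𝒢 := by
  have := Real.Gamma_pos_of_pos hθ
  simp [betaGammaLaw, this.ne']

namespace IsGammaLaw

variable {α : Measure 𝓨} {𝒢 : Measure (Measure 𝓨)}

/-- Bounded measurable test functions include the simple ones, which suffice. Different
constructions with the same shape measure are identified through this, without any coupling. -/
lemma unique {𝒢' : Measure (Measure 𝓨)} (h : IsGammaLaw α 𝒢) (h' : IsGammaLaw α 𝒢') :
    𝒢 = 𝒢' := by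
  have := h.isProbabilityMeasure
  have := h'.isProbabilityMeasure
  refine Measure.ext_of_laplaceFunctional h.ae_finite h'.ae_finite fun g => ?_
  rw [h.laplace (fun y => g y) (by fun_prop) (fun y => (g y).2) (SimpleFunc.bddAbove_nnreal g),
    h'.laplace (fun y => g y) (by fun_prop) (fun y => (g y).2) (SimpleFunc.bddAbove_nnreal g)]

variable [IsFiniteMeasure α]

/-- Exponential tilting of a Gamma law by the total mass is a deterministic rescaling. -/
lemma withDensity_exp_neg (h : IsGammaLaw α 𝒢) {s : ℝ} (hs : 0 ≤ s) :
    𝒢.withDensity (fun μ => ENNReal.ofReal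
        ((1 + s) ^ α.real Set.univ * Real.exp (-(s * μ.real Set.univ)))) =
      𝒢.map fun μ => ENNReal.ofReal (1 + s)⁻¹ • μ := by
  have hp := h.isProbabilityMeasure
  have h1 : 0 < 1 + s := by linarith
  have hd : Measurable fun μ : Measure 𝓨 => ENNReal.ofReal
      ((1 + s) ^ α.real Set.univ * Real.exp (-(s * μ.real Set.univ))) := by
    have := measurable_measureReal (𝓨 := 𝓨) MeasurableSet.univ
    fun_prop
  have hsc : Measurable fun μ : Measure 𝓨 => ENNReal.ofReal (1 + s)⁻¹ • μ :=
    measurable_const_smul_measure _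
  have hfin : IsFiniteMeasure (𝒢.withDensity (fun μ => ENNReal.ofReal
      ((1 + s) ^ α.real Set.univ * Real.exp (-(s * μ.real Set.univ))))) := by
    refine isFiniteMeasure_withDensity (ne_top_of_le_ne_top
      (b := ∫⁻ μ, ENNReal.ofReal ((1 + s) ^ α.real Set.univ) ∂𝒢) (by simp) ?_)
    refine lintegral_mono fun μ => ENNReal.ofReal_le_ofReal ?_
    have : Real.exp (-(s * μ.real Set.univ)) ≤ 1 := by
      rw [Real.exp_le_one_iff, neg_nonpos]; positivity
    exact mul_le_of_le_one_right (by positivity) this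
  have := Measure.isFiniteMeasure_map 𝒢 (fun μ : Measure 𝓨 => ENNReal.ofReal (1 + s)⁻¹ • μ)
  refine Measure.ext_of_laplaceFunctional ?_ ?_ fun g => ?_
  · exact (withDensity_absolutelyContinuous _ _).ae_le h.ae_finite
  · rw [ae_map_iff hsc.aemeasurable measurableSet_isFiniteMeasure]
    filter_upwards [h.ae_finite] with μ hμ
    exact Measure.smul_finite _ ENNReal.ofReal_ne_top
  · have hgm : Measurable fun y => (g y : ℝ) := by fun_prop
    have hgC := SimpleFunc.bddAbove_nnreal g
    have hg0 : ∀ y, 0 ≤ (g y : ℝ) := fun y => (g y).2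
    have hsg : ∃ C, ∀ y, s + (g y : ℝ) ≤ C := by
      obtain ⟨C, hC⟩ := hgC
      exact ⟨s + C, fun y => by linarith [hC y]⟩
    have hdg0 : ∀ y, 0 ≤ (1 + s)⁻¹ * (g y : ℝ) := fun y => by have := hg0 y; positivity
    have hdg : ∃ C, ∀ y, (1 + s)⁻¹ * (g y : ℝ) ≤ C := by
      obtain ⟨C, hC⟩ := hgC
      exact ⟨(1 + s)⁻¹ * C, fun y => by have := hC y; gcongr⟩
    rw [integral_withDensity_eq_integral_toReal_smul hd (ae_of_all _ fun _ => by simp),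
      integral_map hsc.aemeasurable
        (measurable_exp_neg_integral hgm hg0).aestronglyMeasurable]
    -- For finite `μ`, tilting by `exp(-sT)` replaces the test function `g` by `s + g`.
    have eL : ∫ μ, (ENNReal.ofReal ((1 + s) ^ α.real Set.univ *
          Real.exp (-(s * μ.real Set.univ)))).toReal • Real.exp (-∫ y, (g y : ℝ) ∂μ) ∂𝒢 =
        (1 + s) ^ α.real Set.univ * ∫ μ, Real.exp (-∫ y, (s + (g y : ℝ)) ∂μ) ∂𝒢 := by
      rw [← integral_const_mul]
      refine integral_congr_ae ?_
      filter_upwards [h.ae_finite] with μ hμ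
      rw [ENNReal.toReal_ofReal (by positivity), smul_eq_mul, mul_assoc, ← Real.exp_add,
        integral_add (integrable_const _)
          (integrable_of_measurable_nonneg_bounded hgm hg0 hgC), integral_const, smul_eq_mul]
      ring_nf
    have eR : ∫ μ, Real.exp (-∫ y, (g y : ℝ) ∂(ENNReal.ofReal (1 + s)⁻¹ • μ)) ∂𝒢 =
        ∫ μ, Real.exp (-∫ y, (1 + s)⁻¹ * (g y : ℝ) ∂μ) ∂𝒢 := by
      refine integral_congr_ae (ae_of_all _ fun μ => ?_)
      simp only
      rw [integral_smul_measure, integral_const_mul, ENNReal.toReal_ofReal (by positivity),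
        smul_eq_mul]
    rw [eL, eR, h.laplace _ (by fun_prop) (fun y => by have := hg0 y; positivity) hsg,
      h.laplace _ (by fun_prop) hdg0 hdg]
    -- The factorization `1 + s + g = (1+s)(1 + g/(1+s))` separates a constant, which cancels the
    -- normalizing power of `1+s`, from the Laplace functional of the rescaled process.
    have el : ∀ y, Real.log (1 + (s + (g y : ℝ))) =
        Real.log (1 + s) + Real.log (1 + (1 + s)⁻¹ * (g y : ℝ)) := by
      intro y
      have := hdg0 y
      rw [← Real.log_mul h1.ne' (by positivity)]
      congr 1
      field_simp
      ring
    simp_rw [el]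
    rw [integral_add (integrable_const _) (integrable_log_one_add (by fun_prop) hdg0 hdg),
      integral_const, smul_eq_mul, neg_add, Real.exp_add, ← mul_assoc, Real.rpow_def_of_pos h1,
      ← Real.exp_add]
    ring_nf
    simp

/-- Under a Gamma law the total mass is Gamma distributed and independent of the normalized
measure. -/
theorem map_total_normalize (h : IsGammaLaw α 𝒢) (hα : 0 < α.real Set.univ) :
    𝒢.map (fun μ => (μ.real Set.univ, normalizeMeasure μ)) =
      (gammaMeasure (α.real Set.univ) 1).prod (𝒢.map normalizeMeasure) := by
  have hp := h.isProbabilityMeasure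
  have := isProbabilityMeasure_gammaMeasure hα one_pos
  have := Measure.isFiniteMeasure_map 𝒢 (normalizeMeasure (𝓨 := 𝓨))
  have hT := measurable_measureReal (𝓨 := 𝓨) MeasurableSet.univ
  have hN := measurable_normalizeMeasure (𝓨 := 𝓨)
  symm
  refine Measure.prod_eq fun A B hA hB => ?_
  -- Independence amounts to this: on any event of the normalization the total mass still has, up to
  -- a constant, the same Gamma law. Laplace transforms in `s` decide it.
  have key : (𝒢.restrict (normalizeMeasure ⁻¹' B)).map (fun μ => μ.real Set.univ) =
      𝒢 (normalizeMeasure ⁻¹' B) • gammaMeasure (α.real Set.univ) 1 := by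
    have := Measure.isFiniteMeasure_map (𝒢.restrict (normalizeMeasure ⁻¹' B))
      (fun μ : Measure 𝓨 => μ.real Set.univ)
    have : IsFiniteMeasure (𝒢 (normalizeMeasure ⁻¹' B) • gammaMeasure (α.real Set.univ) 1) :=
      Measure.smul_finite _ (measure_ne_top _ _)
    refine Measure.ext_of_laplace_real_one ?_ ?_ fun s hs => ?_
    · rw [ae_map_iff hT.aemeasurable measurableSet_Ici]
      exact ae_of_all _ fun μ => measureReal_nonneg
    · exact Measure.ae_smul_measure ((ae_gammaMeasure_pos _ _).mono fun x hx => hx.le) _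
    · have h1 : 0 < 1 + s := by linarith
      -- The tilted law is a rescaled law, and the event ignores rescaling, so its tilted
      -- probability equals its original one.
      have e := congrArg (fun τ => τ (normalizeMeasure ⁻¹' B)) (h.withDensity_exp_neg hs)
      rw [withDensity_apply _ (hN hB), Measure.map_apply (measurable_const_smul_measure _) (hN hB)] at e
      have e2 : (fun μ : Measure 𝓨 => ENNReal.ofReal (1 + s)⁻¹ • μ) ⁻¹'
          (normalizeMeasure ⁻¹' B) = normalizeMeasure ⁻¹' B := by
        ext μ
        simp only [Set.mem_preimage]
        rw [normalizeMeasure_smul (by simpa using h1) (by simp)]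
      rw [e2] at e
      rw [integral_map hT.aemeasurable (by fun_prop), integral_smul_measure,
        integral_exp_neg_gammaMeasure hα hs,
        integral_eq_lintegral_of_nonneg_ae (ae_of_all _ fun x => (Real.exp_pos _).le)
          (by fun_prop), ← e]
      simp_rw [ENNReal.ofReal_mul (Real.rpow_nonneg h1.le (α.real Set.univ))]
      rw [lintegral_const_mul _ (by fun_prop), ENNReal.toReal_mul,
        ENNReal.toReal_ofReal (by positivity), smul_eq_mul, mul_comm (_ ^ _), mul_assoc,
        ← Real.rpow_add h1]
      simp
  rw [Measure.map_apply (hT.prodMk hN) (hA.prod hB), Measure.map_apply hN hB]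
  have e := congrArg (fun τ => τ A) key
  simp only [Measure.smul_apply, smul_eq_mul] at e
  rw [Measure.map_apply hT hA, Measure.restrict_apply (hT hA)] at e
  rw [mul_comm, ← e]
  rfl

/-- The first marginal of the polar decomposition is a Gamma law, which does not charge `0`; this
makes the normalization a genuine probability measure almost surely. -/
lemma ae_total_pos (h : IsGammaLaw α 𝒢) (hα : 0 < α.real Set.univ) :
    ∀ᵐ μ ∂𝒢, 0 < μ.real Set.univ := by
  have hp := h.isProbabilityMeasure
  have := isProbabilityMeasure_gammaMeasure hα one_pos
  have hT := measurable_measureReal (𝓨 := 𝓨) MeasurableSet.univ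
  have hN := measurable_normalizeMeasure (𝓨 := 𝓨)
  have := Measure.isProbabilityMeasure_map (μ := 𝒢) hN.aemeasurable
  have e : 𝒢.map (fun μ => μ.real Set.univ) = gammaMeasure (α.real Set.univ) 1 := by
    have := congrArg (fun τ => τ.map Prod.fst) (h.map_total_normalize hα)
    simp only [Measure.map_map measurable_fst (hT.prodMk hN), Measure.map_fst_prod,
      measure_univ, one_smul] at this
    exact this
  have h2 := ae_gammaMeasure_pos (α.real Set.univ) 1
  rw [← e, ae_map_iff hT.aemeasurable measurableSet_Ioi] at h2
  exact h2

/-- A Beta-Gamma law is the law of the product of an independent Gamma variable and the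
normalization of a Gamma process. -/
theorem betaGammaLaw_eq (h : IsGammaLaw α 𝒢) {θ q : ℝ} (hθ : 0 < θ) (hq : 0 < q)
    (hα : α.real Set.univ = θ) :
    betaGammaLaw θ (θ - q) 𝒢 = ((gammaMeasure q 1).prod (𝒢.map normalizeMeasure)).map
      fun p => ENNReal.ofReal p.1 • p.2 := by
  have hp := h.isProbabilityMeasure
  have := isProbabilityMeasure_gammaMeasure hθ one_pos
  have := isProbabilityMeasure_gammaMeasure hq one_pos
  have hT := measurable_measureReal (𝓨 := 𝓨) MeasurableSet.univ
  have hN := measurable_normalizeMeasure (𝓨 := 𝓨)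
  have hS := measurable_ofReal_smul_measure (𝓨 := 𝓨)
  have := Measure.isProbabilityMeasure_map (μ := 𝒢) hN.aemeasurable
  have hd : Measurable fun μ : Measure 𝓨 =>
      ENNReal.ofReal (Real.Gamma θ / Real.Gamma (θ - (θ - q))) *
        (μ Set.univ) ^ (-(θ - q)) :=
    ((Measure.measurable_coe MeasurableSet.univ).pow_const _).const_mul _
  refine Measure.ext_of_lintegral _ fun F hF => ?_
  have hFS : Measurable fun p : ℝ × Measure 𝓨 => F (ENNReal.ofReal p.1 • p.2) := hF.comp hS
  rw [betaGammaLaw, lintegral_withDensity_eq_lintegral_mul _ hd hF, lintegral_map hF hS,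
    lintegral_prod_symm _ hFS.aemeasurable]
  -- In polar coordinates the density involves only the mass, so the independent normalization is
  -- untouched and the Gamma factor passes from shape `θ` to shape `q`.
  have e1 : ∫⁻ μ, ((fun μ : Measure 𝓨 =>
      ENNReal.ofReal (Real.Gamma θ / Real.Gamma (θ - (θ - q))) *
        (μ Set.univ) ^ (-(θ - q))) * F) μ ∂𝒢 =
      ∫⁻ μ, (fun p : ℝ × Measure 𝓨 => ENNReal.ofReal (Real.Gamma θ / Real.Gamma q) *
        ENNReal.ofReal p.1 ^ (q - θ) * F (ENNReal.ofReal p.1 • p.2))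
        (μ.real Set.univ, normalizeMeasure μ) ∂𝒢 := by
    refine lintegral_congr_ae ?_
    filter_upwards [h.ae_finite] with μ hμ
    simp only [Pi.mul_apply]
    rw [smul_normalizeMeasure, ofReal_measureReal, sub_sub_cancel, neg_sub]
  rw [e1, ← lintegral_map (f := fun p : ℝ × Measure 𝓨 =>
    ENNReal.ofReal (Real.Gamma θ / Real.Gamma q) *
        ENNReal.ofReal p.1 ^ (q - θ) * F (ENNReal.ofReal p.1 • p.2)) (by fun_prop)
    (hT.prodMk hN), h.map_total_normalize (hα ▸ hθ), hα, lintegral_prod_symm _ (by fun_prop)]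
  refine lintegral_congr fun P => ?_
  exact lintegral_rpow_mul_gammaMeasure hθ hq (hFS.comp measurable_prodMk_right)

end IsGammaLaw

end RandomMeasures

/-! ### The Dirichlet process as a normalized Gamma process. -/

section DirichletLaws

open scoped NNReal

lemma sum_indicator_eq {X ι : Type*} [Fintype ι] {A : ι → Set X}
    (hd : Pairwise fun i j => Disjoint (A i) (A j)) (t : ι → ℝ) {i : ι} {y : X} (hy : y ∈ A i) :
    ∑ j, (A j).indicator (fun _ => t j) y = t i := by
  rw [Finset.sum_eq_single i]
  · simp [hy]
  · intro j _ hj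
    exact Set.indicator_of_notMem (Set.disjoint_left.1 (hd hj.symm) hy) _
  · simp

variable {𝓨 : Type*} [MeasurableSpace 𝓨]

lemma integral_sum_indicator {ι : Type*} [Fintype ι] (μ : Measure 𝓨) [IsFiniteMeasure μ]
    {A : ι → Set 𝓨} (hA : ∀ i, MeasurableSet (A i)) (t : ι → ℝ) :
    ∫ y, ∑ i, (A i).indicator (fun _ => t i) y ∂μ = ∑ i, t i * μ.real (A i) := by
  rw [integral_finsetSum _ fun i _ => (integrable_const _).indicator (hA i)]
  refine Finset.sum_congr rfl fun i _ => ?_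
  rw [integral_indicator_const _ (hA i), smul_eq_mul, mul_comm]

/-- The values of a Gamma process on the cells of a partition are independent Gamma variables. -/
theorem IsGammaLaw.map_partition {α : Measure 𝓨} [IsFiniteMeasure α] {𝒢 : Measure (Measure 𝓨)}
    (h : IsGammaLaw α 𝒢) {ι : Type*} [Fintype ι] {A : ι → Set 𝓨}
    (hA : ∀ i, MeasurableSet (A i)) (hd : Pairwise fun i j => Disjoint (A i) (A j))
    (hU : ⋃ i, A i = Set.univ) :
    𝒢.map (fun μ i => μ.real (A i)) = Measure.pi fun i => gammaOrZero (α.real (A i)) := by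
  have hp := h.isProbabilityMeasure
  have hm : Measurable fun (μ : Measure 𝓨) i => μ.real (A i) :=
    measurable_pi_lambda _ fun i => measurable_measureReal (hA i)
  have := Measure.isProbabilityMeasure_map (μ := 𝒢) hm.aemeasurable
  have : ∀ i, IsProbabilityMeasure (gammaOrZero (α.real (A i))) := fun i =>
    isProbabilityMeasure_gammaOrZero measureReal_nonneg
  refine Measure.ext_of_laplace_real ?_ ?_ fun t => ?_
  · rw [ae_map_iff hm.aemeasurable (by measurability)]
    exact ae_of_all _ fun μ i => measureReal_nonneg
  · rw [ae_all_iff]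
    intro i
    exact (Measure.quasiMeasurePreserving_eval (fun i => gammaOrZero (α.real (A i))) i).ae
      (ae_gammaOrZero_nonneg _)
  · rw [integral_map hm.aemeasurable (Measurable.aestronglyMeasurable (by fun_prop))]
    have e1 : ∫ μ, Real.exp (-∑ i, (t i : ℝ) * μ.real (A i)) ∂𝒢 =
        ∫ μ, Real.exp (-∫ y, ∑ i, (A i).indicator (fun _ => (t i : ℝ)) y ∂μ) ∂𝒢 := by
      refine integral_congr_ae ?_
      filter_upwards [h.ae_finite] with μ hμ
      rw [integral_sum_indicator μ hA]
    have hb : ∃ C, ∀ y, ∑ i, (A i).indicator (fun _ => (t i : ℝ)) y ≤ C :=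
      ⟨∑ i, (t i : ℝ), fun y => Finset.sum_le_sum fun i _ =>
        Set.indicator_le_self' (fun _ _ => (t i).2) y⟩
    rw [e1, h.laplace (fun y => ∑ i, (A i).indicator (fun _ => (t i : ℝ)) y)
      (Finset.measurable_fun_sum _ fun i _ => measurable_const.indicator (hA i))
      (fun y => Finset.sum_nonneg fun i _ => Set.indicator_nonneg (fun _ _ => (t i).2) y) hb]
    -- Exactly one indicator is nonzero at each point, so the logarithm passes inside the sum. The
    -- Laplace functional then becomes a product over the cells, which is independence.
    have e2 : ∀ y, Real.log (1 + ∑ i, (A i).indicator (fun _ => (t i : ℝ)) y) =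
        ∑ i, (A i).indicator (fun _ => Real.log (1 + t i)) y := by
      intro y
      obtain ⟨i, hi⟩ := Set.mem_iUnion.1 (hU ▸ Set.mem_univ y)
      rw [sum_indicator_eq hd _ hi, sum_indicator_eq hd _ hi]
    simp_rw [e2]
    rw [integral_sum_indicator α hA]
    simp_rw [← Finset.sum_neg_distrib, Real.exp_sum]
    rw [integral_fintype_prod_eq_prod (fun i x => Real.exp (-((t i : ℝ) * x)))]
    refine Finset.prod_congr rfl fun i _ => ?_
    have h1 : (0 : ℝ) < 1 + t i := by have := (t i).2; positivity
    rw [integral_exp_neg_gammaOrZero (s := t i) measureReal_nonneg (t i).2, Real.rpow_def_of_pos h1]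
    ring_nf

/-- The normalization of a Gamma process is a Dirichlet process. -/
theorem IsGammaLaw.isDirichletLaw {α : Measure 𝓨} [IsFiniteMeasure α]
    {𝒢 : Measure (Measure 𝓨)} (h : IsGammaLaw α 𝒢) (hα : 0 < α.real Set.univ) :
    IsDirichletLaw α (𝒢.map normalizeMeasure) := by
  have hp := h.isProbabilityMeasure
  have hN := measurable_normalizeMeasure (𝓨 := 𝓨)
  refine ⟨Measure.isProbabilityMeasure_map hN.aemeasurable, ?_, fun k A hA hd hU => ?_⟩
  · have hs : MeasurableSet {P : Measure 𝓨 | IsProbabilityMeasure P} := by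
      have e : {P : Measure 𝓨 | IsProbabilityMeasure P} = (fun P => P Set.univ) ⁻¹' {1} := by
        ext P
        exact isProbabilityMeasure_iff
      rw [e]
      exact Measure.measurable_coe MeasurableSet.univ (measurableSet_singleton 1)
    rw [ae_map_iff hN.aemeasurable hs]
    filter_upwards [h.ae_finite, h.ae_total_pos hα] with μ hμ hμ0
    refine ⟨?_⟩
    rw [normalizeMeasure, Measure.smul_apply, smul_eq_mul, ENNReal.inv_mul_cancel]
    · intro h0
      simp [Measure.real, h0] at hμ0
    · exact measure_ne_top _ _
  · have hm : Measurable fun (μ : Measure 𝓨) i => μ.real (A i) :=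
      measurable_pi_lambda _ fun i => measurable_measureReal (hA i)
    rw [dirichletMeasure, ← h.map_partition hA hd hU, Measure.map_map hm hN,
      Measure.map_map (by fun_prop) hm]
    refine Measure.map_congr ?_
    filter_upwards [h.ae_finite] with μ hμ
    funext i
    simp only [Function.comp_apply]
    -- The total mass is the sum of the masses of the cells, which is the denominator in
    -- `dirichletMeasure`.
    rw [normalizeMeasure_real, ← hU, measureReal_iUnion_fintype hd hA]

/-- A Dirichlet law is determined by its shape measure. -/
theorem IsDirichletLaw.unique {α : Measure 𝓨} {𝒟 𝒟' : Measure (Measure 𝓨)}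
    (h : IsDirichletLaw α 𝒟) (h' : IsDirichletLaw α 𝒟') : 𝒟 = 𝒟' := by
  have := h.isProbabilityMeasure
  have := h'.isProbabilityMeasure
  refine Measure.ext_of_laplaceFunctional (h.ae_probability.mono fun _ _ => inferInstance)
    (h'.ae_probability.mono fun _ _ => inferInstance) fun g => ?_
  -- The level sets of the simple function `g` form a finite partition, and the integral of `g` is
  -- linear in their masses; so the Dirichlet marginals fix the Laplace functional.
  let e := g.range.equivFin
  let A : Fin g.range.card → Set 𝓨 := fun i => g ⁻¹' {((e.symm i : g.range) : ℝ≥0)}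
  have hA : ∀ i, MeasurableSet (A i) := fun i => g.measurableSet_fiber _
  have hd : Pairwise fun i j => Disjoint (A i) (A j) := by
    intro i j hij
    refine Disjoint.preimage _ (Set.disjoint_singleton.2 fun hc => hij ?_)
    exact e.symm.injective (Subtype.ext hc)
  have hmem : ∀ y, y ∈ A (e ⟨g y, g.mem_range_self y⟩) := fun y => by simp [A]
  have hU : ⋃ i, A i = Set.univ :=
    Set.eq_univ_of_forall fun y => Set.mem_iUnion.2 ⟨_, hmem y⟩
  have hm : Measurable fun (μ : Measure 𝓨) i => μ.real (A i) :=
    measurable_pi_lambda _ fun i => measurable_measureReal (hA i)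
  have key : ∀ {τ : Measure (Measure 𝓨)}, IsDirichletLaw α τ →
      ∫ μ, Real.exp (-∫ y, (g y : ℝ) ∂μ) ∂τ =
        ∫ x, Real.exp (-∑ i, ((e.symm i : g.range) : ℝ≥0) * x i)
          ∂(dirichletMeasure fun i => α.real (A i)) := by
    intro τ hτ
    rw [← hτ.marginals _ A hA hd hU,
      integral_map hm.aemeasurable (Measurable.aestronglyMeasurable (by fun_prop))]
    refine integral_congr_ae ?_
    filter_upwards [hτ.ae_probability] with μ hμ
    rw [← integral_sum_indicator μ hA]
    congr 3
    funext y
    rw [sum_indicator_eq hd _ (hmem y)]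
    simp
  rw [key h, key h']

end DirichletLaws

/-! ### Gamma processes with added atoms, and the derivative of the Laplace functional. -/

section Palm

open scoped NNReal

variable {𝓨 : Type*} [MeasurableSpace 𝓨]

lemma measurable_sum_smul_dirac {X ι : Type*} [MeasurableSpace X] [Fintype ι]
    {M : X → Measure 𝓨} (hM : Measurable M) {w : X → ι → ℝ} (hw : Measurable w)
    {y : X → ι → 𝓨} (hy : Measurable y) :
    Measurable fun x => M x + ∑ i, ENNReal.ofReal (w x i) • Measure.dirac (y x i) := by
  refine hM.add (Finset.measurable_fun_sum _ fun i _ => ?_)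
  have h1 : Measurable fun x => Measure.dirac (y x i) :=
    Measure.measurable_dirac.comp ((measurable_pi_apply i).comp hy)
  have h2 : Measurable fun x => w x i := (measurable_pi_apply i).comp hw
  exact measurable_ofReal_smul_measure.comp (h2.prodMk h1)

/-- The law of `M + ∑ i, G i δ_{y i}`, where `M` has law `𝒢` and the `G i` are independent of `M`
and of each other, `G i` being Gamma with shape `e i`. -/
noncomputable def atomLaw (𝒢 : Measure (Measure 𝓨)) {ι : Type*} [Fintype ι] (e : ι → ℝ) (y : ι → 𝓨) :
    Measure (Measure 𝓨) :=
  (𝒢.prod (Measure.pi fun i => gammaMeasure (e i) 1)).map fun p =>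
    p.1 + ∑ i, ENNReal.ofReal (p.2 i) • Measure.dirac (y i)

lemma measurable_add_atoms {ι : Type*} [Fintype ι] (y : ι → 𝓨) :
    Measurable fun p : Measure 𝓨 × (ι → ℝ) =>
      p.1 + ∑ i, ENNReal.ofReal (p.2 i) • Measure.dirac (y i) :=
  measurable_sum_smul_dirac measurable_fst measurable_snd measurable_const

lemma isFiniteMeasure_add_atoms {ι : Type*} [Fintype ι] (μ : Measure 𝓨) [IsFiniteMeasure μ]
    (w : ι → ℝ≥0∞) (hw : ∀ i, w i ≠ ⊤) (y : ι → 𝓨) :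
    IsFiniteMeasure (μ + ∑ i, w i • Measure.dirac (y i)) := by
  have : ∀ i, IsFiniteMeasure (w i • Measure.dirac (y i)) := fun i =>
    Measure.smul_finite _ (hw i)
  infer_instance

lemma integral_add_atoms {ι : Type*} [Fintype ι] (μ : Measure 𝓨) [IsFiniteMeasure μ]
    (w : ι → ℝ) (hw : ∀ i, 0 ≤ w i) (y : ι → 𝓨) {g : 𝓨 → ℝ} (hg : Measurable g)
    (h0 : ∀ y, 0 ≤ g y) (hC : ∃ C, ∀ y, g y ≤ C) :
    ∫ x, g x ∂(μ + ∑ i, ENNReal.ofReal (w i) • Measure.dirac (y i)) =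
      ∫ x, g x ∂μ + ∑ i, w i * g (y i) := by
  have hf : ∀ i, IsFiniteMeasure (ENNReal.ofReal (w i) • Measure.dirac (y i)) := fun i =>
    Measure.smul_finite _ ENNReal.ofReal_ne_top
  rw [integral_add_measure (integrable_of_measurable_nonneg_bounded hg h0 hC)
    (integrable_of_measurable_nonneg_bounded hg h0 hC),
    integral_finsetSum_measure fun i _ => integrable_of_measurable_nonneg_bounded hg h0 hC]
  congr 1
  refine Finset.sum_congr rfl fun i _ => ?_
  rw [integral_smul_measure, integral_dirac' _ _ hg.stronglyMeasurable,
    ENNReal.toReal_ofReal (hw i), smul_eq_mul]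

/-- Adding independent Gamma weighted atoms to a Gamma process gives a Gamma process. -/
theorem IsGammaLaw.atomLaw {α : Measure 𝓨} [IsFiniteMeasure α] {𝒢 : Measure (Measure 𝓨)}
    (h : IsGammaLaw α 𝒢) {ι : Type*} [Fintype ι] {e : ι → ℝ} (he : ∀ i, 0 < e i) (y : ι → 𝓨) :
    IsGammaLaw (α + ∑ i, ENNReal.ofReal (e i) • Measure.dirac (y i)) (atomLaw 𝒢 e y) := by
  have hp := h.isProbabilityMeasure
  have hpr : ∀ i, IsProbabilityMeasure (gammaMeasure (e i) 1) := fun i =>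
    isProbabilityMeasure_gammaMeasure (he i) one_pos
  have hm := measurable_add_atoms y
  have hG : ∀ᵐ p ∂(𝒢.prod (Measure.pi fun i => gammaMeasure (e i) 1)), ∀ i, 0 ≤ p.2 i := by
    refine Measure.quasiMeasurePreserving_snd.ae (p := fun x : ι → ℝ => ∀ i, 0 ≤ x i) ?_
    rw [ae_all_iff]
    intro i
    exact (Measure.quasiMeasurePreserving_eval (fun i => gammaMeasure (e i) 1) i).ae
      ((ae_gammaMeasure_pos _ _).mono fun x hx => hx.le)
  have hM : ∀ᵐ p ∂(𝒢.prod (Measure.pi fun i => gammaMeasure (e i) 1)),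
      IsFiniteMeasure p.1 :=
    Measure.quasiMeasurePreserving_fst.ae (p := fun μ => IsFiniteMeasure μ) h.ae_finite
  refine ⟨Measure.isProbabilityMeasure_map hm.aemeasurable, ?_, fun g hg h0 hC => ?_⟩
  · rw [_root_.atomLaw, ae_map_iff hm.aemeasurable measurableSet_isFiniteMeasure]
    filter_upwards [hM] with p hp
    exact isFiniteMeasure_add_atoms _ _ (fun i => ENNReal.ofReal_ne_top) _
  · rw [_root_.atomLaw, integral_map hm.aemeasurable
      (measurable_exp_neg_integral hg h0).aestronglyMeasurable]
    have e1 : ∫ p, Real.exp (-∫ x, g x ∂(p.1 + ∑ i, ENNReal.ofReal (p.2 i) •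
          Measure.dirac (y i))) ∂(𝒢.prod (Measure.pi fun i => gammaMeasure (e i) 1)) =
        ∫ p, Real.exp (-∫ x, g x ∂p.1) * Real.exp (-∑ i, p.2 i * g (y i))
          ∂(𝒢.prod (Measure.pi fun i => gammaMeasure (e i) 1)) := by
      refine integral_congr_ae ?_
      filter_upwards [hM, hG] with p hp1 hp2
      rw [integral_add_atoms _ _ hp2 _ hg h0 hC, neg_add, Real.exp_add]
    have hlC : ∃ C, ∀ y, Real.log (1 + g y) ≤ C := by
      obtain ⟨C, hC⟩ := hC
      refine ⟨C, fun y => ?_⟩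
      have := Real.log_le_sub_one_of_pos (x := 1 + g y) (by linarith [h0 y])
      linarith [hC y]
    rw [e1, integral_prod_mul (fun μ : Measure 𝓨 => Real.exp (-∫ x, g x ∂μ))
      (fun x : ι → ℝ => Real.exp (-∑ i, x i * g (y i))), h.laplace g hg h0 hC,
      integral_add_atoms α e (fun i => (he i).le) y (g := fun y => Real.log (1 + g y))
        (by fun_prop) (fun y => Real.log_nonneg (by linarith [h0 y])) hlC, neg_add, Real.exp_add]
    congr 1
    -- The weight at `y i` contributes `(1 + g (y i))^(-e i)`, exactly what an atom of mass `e i` in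
    -- the shape measure contributes. The points `y i` need not be distinct.
    simp_rw [← Finset.sum_neg_distrib, Real.exp_sum]
    rw [integral_fintype_prod_eq_prod (fun i x => Real.exp (-(x * g (y i))))]
    refine Finset.prod_congr rfl fun i _ => ?_
    have h1 : 0 < 1 + g (y i) := by linarith [h0 (y i)]
    simp_rw [mul_comm _ (g (y i))]
    rw [integral_exp_neg_gammaMeasure (he i) (h0 _), Real.rpow_def_of_pos h1]
    ring_nf

/-- A bound free of `x`, coming from `s x ≤ exp(s x)` and `1/s ≤ 2`. It dominates the derivative of
the Laplace functional without knowing beforehand that the total mass is integrable. -/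
lemma mul_exp_neg_le {s x : ℝ} (hs : 1 / 2 ≤ s) (hx : 0 ≤ x) : x * Real.exp (-(s * x)) ≤ 2 := by
  have h1 : s * x ≤ Real.exp (s * x) := by linarith [Real.add_one_le_exp (s * x)]
  have h2 : x / 2 ≤ s * x := by nlinarith
  rw [Real.exp_neg, ← div_eq_mul_inv, div_le_iff₀ (Real.exp_pos _)]
  linarith

/-- The first moment of the total mass under an exponentially tilted Gamma law. -/
lemma IsGammaLaw.integral_total_mul_exp {α : Measure 𝓨} [IsFiniteMeasure α]
    {𝒢 : Measure (Measure 𝓨)} (h : IsGammaLaw α 𝒢) {g : 𝓨 → ℝ} (hg : Measurable g)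
    (h0 : ∀ y, 0 ≤ g y) (hC : ∃ C, ∀ y, g y ≤ C) :
    ∫ μ, μ.real Set.univ * Real.exp (-(μ.real Set.univ + ∫ y, g y ∂μ)) ∂𝒢 =
      Real.exp (-∫ y, Real.log (1 + (1 + g y)) ∂α) * ∫ y, (1 + (1 + g y))⁻¹ ∂α := by
  have hp := h.isProbabilityMeasure
  have hT := measurable_measureReal (𝓨 := 𝓨) MeasurableSet.univ
  have hI := measurable_integral_measure hg h0
  have hI0 : ∀ μ : Measure 𝓨, 0 ≤ ∫ y, g y ∂μ := fun μ => integral_nonneg h0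
  have hb : ∀ s ∈ Metric.ball (1 : ℝ) (1 / 2), 1 / 2 ≤ s := by
    intro s hs
    rw [Metric.mem_ball, Real.dist_eq, abs_lt] at hs
    linarith [hs.1]
  have hnhds : Metric.ball (1 : ℝ) (1 / 2) ∈ nhds (1 : ℝ) := Metric.ball_mem_nhds _ (by norm_num)
  -- Both expressions for the Laplace functional at `s + g` are differentiated at `s = 1`. This
  -- interior point keeps `T exp(-sT)` bounded on the ball of radius `1/2`.
  have hA : HasDerivAt (fun s : ℝ => ∫ μ, Real.exp (-(s * μ.real Set.univ + ∫ y, g y ∂μ)) ∂𝒢)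
      (∫ μ, -(μ.real Set.univ * Real.exp (-(1 * μ.real Set.univ + ∫ y, g y ∂μ))) ∂𝒢) 1 := by
    refine (hasDerivAt_integral_of_dominated_loc_of_deriv_le (bound := fun _ => (2 : ℝ))
      (F' := fun s (μ : Measure 𝓨) =>
        -(μ.real Set.univ * Real.exp (-(s * μ.real Set.univ + ∫ y, g y ∂μ))))
      hnhds ?_ ?_ ?_ ?_ ?_ ?_).2
    · exact Filter.Eventually.of_forall fun s => Measurable.aestronglyMeasurable (by fun_prop)
    · refine Integrable.of_bound (Measurable.aestronglyMeasurable (by fun_prop)) 1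
        (ae_of_all _ fun μ => ?_)
      rw [Real.norm_eq_abs, Real.abs_exp, Real.exp_le_one_iff, neg_nonpos]
      have := hI0 μ
      positivity
    · exact Measurable.aestronglyMeasurable (by fun_prop)
    · refine ae_of_all _ fun μ s hs => ?_
      have h1 := mul_exp_neg_le (hb s hs) (measureReal_nonneg (μ := μ) (s := Set.univ))
      rw [norm_neg, Real.norm_eq_abs, abs_of_nonneg (by positivity)]
      refine le_trans ?_ h1
      gcongr
      linarith [hI0 μ]
    · exact integrable_const _
    · refine ae_of_all _ fun μ s _ => ?_
      have h1 : HasDerivAt (fun s : ℝ => -(s * μ.real Set.univ + ∫ y, g y ∂μ))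
          (-(1 * μ.real Set.univ)) s :=
        (((hasDerivAt_id s).mul_const _).add_const _).neg
      exact h1.exp.congr_deriv (by ring)
  have hB : HasDerivAt (fun s : ℝ => ∫ y, Real.log (1 + (s + g y)) ∂α)
      (∫ y, (1 + (1 + g y))⁻¹ ∂α) 1 := by
    refine (hasDerivAt_integral_of_dominated_loc_of_deriv_le (bound := fun _ => (1 : ℝ))
      (F' := fun s y => (1 + (s + g y))⁻¹) hnhds ?_ ?_ ?_ ?_ ?_ ?_).2
    · exact Filter.Eventually.of_forall fun s => Measurable.aestronglyMeasurable (by fun_prop)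
    · obtain ⟨C, hC⟩ := hC
      exact integrable_log_one_add (by fun_prop) (fun y => by linarith [h0 y])
        ⟨1 + C, fun y => by linarith [hC y]⟩
    · exact Measurable.aestronglyMeasurable (by fun_prop)
    · refine ae_of_all _ fun y s hs => ?_
      have := hb s hs
      have := h0 y
      rw [Real.norm_eq_abs, abs_of_nonneg (inv_nonneg.2 (by linarith))]
      exact inv_le_one_of_one_le₀ (by linarith)
    · exact integrable_const _
    · refine ae_of_all _ fun y s hs => ?_
      have := hb s hs
      have := h0 y
      have h1 : HasDerivAt (fun s : ℝ => 1 + (s + g y)) 1 s :=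
        ((hasDerivAt_id s).add_const _).const_add _
      exact (h1.log (by linarith)).congr_deriv (one_div _)
  have hAB : (fun s : ℝ => ∫ μ, Real.exp (-(s * μ.real Set.univ + ∫ y, g y ∂μ)) ∂𝒢) =ᶠ[nhds 1]
      fun s => Real.exp (-∫ y, Real.log (1 + (s + g y)) ∂α) := by
    filter_upwards [hnhds] with s hs
    have hs := hb s hs
    have hsC : ∃ C, ∀ y, s + g y ≤ C := by
      obtain ⟨C, hC⟩ := hC
      exact ⟨s + C, fun y => by linarith [hC y]⟩
    rw [← h.laplace (fun y => s + g y) (by fun_prop) (fun y => by linarith [h0 y]) hsC]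
    refine integral_congr_ae ?_
    filter_upwards [h.ae_finite] with μ hμ
    rw [integral_add (integrable_const _) (integrable_of_measurable_nonneg_bounded hg h0 hC),
      integral_const, smul_eq_mul, mul_comm s]
  have e := hA.unique (hB.neg.exp.congr_of_eventuallyEq hAB)
  rw [integral_neg] at e
  simp only [one_mul, Pi.neg_apply] at e
  linarith

end Palm

/-! ### The Palm formula and its iteration along the urn. -/

section Urn

open scoped NNReal

variable {𝓨 : Type*} [MeasurableSpace 𝓨]

/-- Palm formula: size-biasing a Gamma law by the total mass amounts to adding to the shape
measure a unit atom with location distributed as the shape measure. -/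
theorem IsGammaLaw.lintegral_total_mul {α : Measure 𝓨} [IsFiniteMeasure α]
    {𝒢 : Measure (Measure 𝓨)} (h : IsGammaLaw α 𝒢) {K : 𝓨 → Measure (Measure 𝓨)}
    (hKm : Measurable K) (hK : ∀ z, IsGammaLaw (α + Measure.dirac z) (K z))
    {F : Measure 𝓨 → ℝ≥0∞} (hF : Measurable F) :
    ∫⁻ z, ∫⁻ μ, F μ ∂K z ∂α = ∫⁻ μ, μ Set.univ * F μ ∂𝒢 := by
  have hp := h.isProbabilityMeasure
  have hKp := fun z => (hK z).isProbabilityMeasure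
  have hU : Measurable fun μ : Measure 𝓨 => μ Set.univ :=
    Measure.measurable_coe MeasurableSet.univ
  have hT := measurable_measureReal (𝓨 := 𝓨) MeasurableSet.univ
  -- The size-biased law is not yet known to be finite. The weight `exp(-T)` makes it so, which
  -- gives access to Laplace uniqueness, and being positive and finite it can be divided out again.
  set w : Measure 𝓨 → ℝ≥0∞ := fun μ => ENNReal.ofReal (Real.exp (-μ.real Set.univ)) with hw
  have hwm : Measurable w := by fun_prop
  have hw0 : ∀ μ, w μ ≠ 0 := fun μ => by simp [hw, Real.exp_pos]
  have hwt : ∀ μ, w μ ≠ ⊤ := fun μ => ENNReal.ofReal_ne_top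
  have hw1 : ∀ μ, w μ ≤ 1 := fun μ => by
    rw [hw, ENNReal.ofReal_le_one, Real.exp_le_one_iff, neg_nonpos]
    exact measureReal_nonneg
  have hKfin : ∀ᵐ μ ∂α.bind K, IsFiniteMeasure μ := by
    rw [ae_iff]
    change (α.bind K) {μ | IsFiniteMeasure μ}ᶜ = 0
    rw [Measure.bind_apply measurableSet_isFiniteMeasure.compl hKm.aemeasurable]
    refine (lintegral_congr fun z => ?_).trans lintegral_zero
    exact (ae_iff (p := fun μ => IsFiniteMeasure μ)).1 (hK z).ae_finite
  have hbf : IsFiniteMeasure (α.bind K) := by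
    refine ⟨?_⟩
    rw [Measure.bind_apply MeasurableSet.univ hKm.aemeasurable]
    simp
  have hsz : IsFiniteMeasure ((𝒢.withDensity fun μ => μ Set.univ).withDensity w) := by
    rw [← withDensity_mul _ hU hwm]
    refine isFiniteMeasure_withDensity (ne_top_of_le_ne_top (b := ∫⁻ μ, 2 ∂𝒢) (by simp) ?_)
    refine lintegral_mono_ae ?_
    filter_upwards [h.ae_finite] with μ hμ
    rw [Pi.mul_apply, hw, ← ofReal_measureReal, ← ENNReal.ofReal_mul measureReal_nonneg]
    refine (ENNReal.ofReal_le_ofReal ?_).trans_eq (ENNReal.ofReal_ofNat 2)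
    simpa using mul_exp_neg_le (s := 1) (by norm_num) (measureReal_nonneg (μ := μ) (s := Set.univ))
  have hbw : IsFiniteMeasure ((α.bind K).withDensity w) := by
    refine isFiniteMeasure_withDensity (ne_top_of_le_ne_top (b := ∫⁻ μ, 1 ∂α.bind K) (by simp) ?_)
    exact lintegral_mono hw1
  have key : (α.bind K).withDensity w = (𝒢.withDensity fun μ => μ Set.univ).withDensity w := by
    refine Measure.ext_of_laplaceFunctional
      ((withDensity_absolutelyContinuous _ _).ae_le hKfin)
      (((withDensity_absolutelyContinuous _ _).trans
        (withDensity_absolutelyContinuous _ _)).ae_le h.ae_finite) fun g => ?_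
    have hgm : Measurable fun y => (g y : ℝ) := by fun_prop
    have hgC := SimpleFunc.bddAbove_nnreal g
    have hg0 : ∀ y, 0 ≤ (g y : ℝ) := fun y => (g y).2
    have hgI := measurable_exp_neg_integral hgm hg0
    have hg1C : ∃ C, ∀ y, 1 + (g y : ℝ) ≤ C := by
      obtain ⟨C, hC⟩ := hgC
      exact ⟨1 + C, fun y => by linarith [hC y]⟩
    have hg1I : Measurable fun μ : Measure 𝓨 => Real.exp (-∫ y, (1 + (g y : ℝ)) ∂μ) :=
      measurable_exp_neg_integral (by fun_prop) fun y => by linarith [hg0 y]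
    rw [integral_withDensity_eq_integral_toReal_smul hwm (ae_of_all _ fun μ => (hwt μ).lt_top),
      integral_withDensity_eq_integral_toReal_smul hwm (ae_of_all _ fun μ => (hwt μ).lt_top),
      integral_withDensity_eq_integral_toReal_smul hU
        (h.ae_finite.mono fun μ hμ => measure_lt_top _ _)]
    have eR : ∫ μ, (μ Set.univ).toReal • (w μ).toReal • Real.exp (-∫ y, (g y : ℝ) ∂μ) ∂𝒢 =
        ∫ μ, μ.real Set.univ * Real.exp (-(μ.real Set.univ + ∫ y, (g y : ℝ) ∂μ)) ∂𝒢 := by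
      refine integral_congr_ae (ae_of_all _ fun μ => ?_)
      simp only [hw, smul_eq_mul]
      rw [ENNReal.toReal_ofReal (Real.exp_pos _).le, ← Real.exp_add, neg_add]
      rfl
    rw [eR, h.integral_total_mul_exp hgm hg0 hgC]
    have eL : ∫ μ, (w μ).toReal • Real.exp (-∫ y, (g y : ℝ) ∂μ) ∂α.bind K =
        ∫ μ, Real.exp (-∫ y, (1 + (g y : ℝ)) ∂μ) ∂α.bind K := by
      refine integral_congr_ae ?_
      filter_upwards [hKfin] with μ hμ
      simp only [hw, smul_eq_mul]
      rw [ENNReal.toReal_ofReal (Real.exp_pos _).le, ← Real.exp_add, integral_add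
        (integrable_const _) (integrable_of_measurable_nonneg_bounded hgm hg0 hgC),
        integral_const, smul_eq_mul, mul_one, neg_add]
    -- The unit atom at `z` multiplies the Laplace functional at `1 + g` by `1/(2 + g z)`; its
    -- integral over `α` is the factor produced by the derivative at `s = 1`.
    have eK : ∀ z, ∫⁻ μ, ENNReal.ofReal (Real.exp (-∫ y, (1 + (g y : ℝ)) ∂μ)) ∂K z =
        ENNReal.ofReal (Real.exp (-∫ y, Real.log (1 + (1 + (g y : ℝ))) ∂α) *
          (1 + (1 + (g z : ℝ)))⁻¹) := by
      intro z
      have hz := hg0 z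
      have hlog : ∀ (ν : Measure 𝓨) [IsFiniteMeasure ν],
          Integrable (fun y => Real.log (1 + (1 + (g y : ℝ)))) ν := fun ν _ =>
        integrable_log_one_add (by fun_prop) (fun y => by linarith [hg0 y]) hg1C
      rw [← ofReal_integral_eq_lintegral_ofReal ?_ (ae_of_all _ fun μ => (Real.exp_pos _).le),
        (hK z).laplace _ (by fun_prop) (fun y => by linarith [hg0 y]) hg1C,
        integral_add_measure (hlog _) (hlog _), integral_dirac' _ _
          (Measurable.stronglyMeasurable (by fun_prop)), neg_add, Real.exp_add, Real.exp_neg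
          (Real.log _), Real.exp_log (by positivity)]
      refine Integrable.of_bound hg1I.aestronglyMeasurable 1 (ae_of_all _ fun μ => ?_)
      rw [Real.norm_eq_abs, Real.abs_exp, Real.exp_le_one_iff, neg_nonpos]
      exact integral_nonneg fun y => by have := hg0 y; positivity
    rw [eL, integral_eq_lintegral_of_nonneg_ae (ae_of_all _ fun μ => (Real.exp_pos _).le)
      hg1I.aestronglyMeasurable, Measure.lintegral_bind hKm.aemeasurable
        hg1I.ennreal_ofReal.aemeasurable, lintegral_congr eK, ← integral_const_mul,
      integral_eq_lintegral_of_nonneg_ae (f := fun z =>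
        Real.exp (-∫ y, Real.log (1 + (1 + (g y : ℝ))) ∂α) * (1 + (1 + (g z : ℝ)))⁻¹)
        (ae_of_all _ fun z => by
          have := hg0 z
          simp only [Pi.zero_apply]
          positivity)
        (Measurable.aestronglyMeasurable (by fun_prop))]
  have key2 : α.bind K = 𝒢.withDensity fun μ => μ Set.univ := by
    rw [← withDensity_inv_same (μ := α.bind K) hwm (ae_of_all _ hw0) (ae_of_all _ hwt), key,
      withDensity_inv_same hwm (ae_of_all _ hw0) (ae_of_all _ hwt)]
  rw [← Measure.lintegral_bind hKm.aemeasurable hF.aemeasurable, key2,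
    lintegral_withDensity_eq_lintegral_mul _ hU hF]
  rfl

lemma lintegral_atomLaw (𝒢 : Measure (Measure 𝓨)) {ι : Type*} [Fintype ι] (e : ι → ℝ)
    (y : ι → 𝓨) {F : Measure 𝓨 → ℝ≥0∞} (hF : Measurable F) :
    ∫⁻ μ, F μ ∂atomLaw 𝒢 e y = ∫⁻ p, F (p.1 + ∑ i, ENNReal.ofReal (p.2 i) •
      Measure.dirac (y i)) ∂(𝒢.prod (Measure.pi fun i => gammaMeasure (e i) 1)) := by
  rw [atomLaw, lintegral_map hF (measurable_add_atoms y)]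

lemma measurable_atomLaw (𝒢 : Measure (Measure 𝓨)) [SFinite 𝒢] {ι : Type*} [Fintype ι]
    {e : ι → ℝ} (he : ∀ i, 0 < e i) : Measurable (atomLaw 𝒢 e) := by
  have : ∀ i, IsProbabilityMeasure (gammaMeasure (e i) 1) := fun i =>
    isProbabilityMeasure_gammaMeasure (he i) one_pos
  refine Measure.measurable_of_measurable_coe _ fun s hs => ?_
  have hm : Measurable fun x : (ι → 𝓨) × (Measure 𝓨 × (ι → ℝ)) =>
      x.2.1 + ∑ i, ENNReal.ofReal (x.2.2 i) • Measure.dirac (x.1 i) :=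
    measurable_sum_smul_dirac (measurable_fst.comp measurable_snd)
      (measurable_snd.comp measurable_snd) measurable_fst
  simp_rw [atomLaw, Measure.map_apply (measurable_add_atoms _) hs]
  exact measurable_measure_prodMk_left (hm hs)

instance sFinite_urnProduct (α : Measure 𝓨) [SFinite α] (n : ℕ) : SFinite (urnProduct α n) := by
  induction n with
  | zero => unfold urnProduct; infer_instance
  | succ n ih => unfold urnProduct; infer_instance

lemma measurable_snoc (n : ℕ) :
    Measurable fun p : (Fin n → 𝓨) × 𝓨 => (Fin.snoc p.1 p.2 : Fin (n + 1) → 𝓨) := by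
  refine measurable_pi_lambda _ fun i => ?_
  refine Fin.lastCases ?_ (fun j => ?_) i
  · simpa using measurable_snd
  · simp only [Fin.snoc_castSucc]
    fun_prop

lemma lintegral_urnProduct_succ (α : Measure 𝓨) [SFinite α] (n : ℕ)
    {F : (Fin (n + 1) → 𝓨) → ℝ≥0∞} (hF : Measurable F) :
    ∫⁻ y, F y ∂urnProduct α (n + 1) =
      ∫⁻ y, ∫⁻ z, F (Fin.snoc y z) ∂(α + ∑ i, Measure.dirac (y i)) ∂urnProduct α n := by
  have hFs : Measurable fun p : (Fin n → 𝓨) × 𝓨 => F (Fin.snoc p.1 p.2 : Fin (n + 1) → 𝓨) :=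
    hF.comp (measurable_snoc n)
  have : IsSFiniteKernel (∑ j : Fin n,
      Kernel.deterministic (fun y : Fin n → 𝓨 => y j) (measurable_pi_apply j)) :=
    Kernel.IsSFiniteKernel.finsetSum _ fun j _ => inferInstance
  rw [urnProduct, lintegral_map hF (measurable_snoc n),
    Measure.lintegral_compProd hFs]
  refine lintegral_congr fun y => ?_
  congr 1
  simp [Kernel.deterministic_apply]

/-- Mixing the Gamma laws with shape `α + ∑ i, δ_{y i}` over the urn sequence gives the law
`T ^ n 𝒢(dμ)`. -/
theorem IsGammaLaw.lintegral_urnProduct {α : Measure 𝓨} [IsFiniteMeasure α]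
    {𝒢 : Measure (Measure 𝓨)} (h : IsGammaLaw α 𝒢) (n : ℕ) {F : Measure 𝓨 → ℝ≥0∞}
    (hF : Measurable F) :
    ∫⁻ y, ∫⁻ μ, F μ ∂(_root_.atomLaw 𝒢 (fun _ : Fin n => 1) y) ∂urnProduct α n =
      ∫⁻ μ, (μ Set.univ) ^ n * F μ ∂𝒢 := by
  have hp := h.isProbabilityMeasure
  have hU : Measurable fun μ : Measure 𝓨 => μ Set.univ :=
    Measure.measurable_coe MeasurableSet.univ
  induction n generalizing F with
  | zero =>
    have hm := measurable_atomLaw 𝒢 (e := fun _ : Fin 0 => 1) (by simp)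
    have hFm : Measurable fun y => ∫⁻ μ, F μ ∂(_root_.atomLaw 𝒢 (fun _ : Fin 0 => 1) y) :=
      (Measure.measurable_lintegral hF).comp hm
    rw [urnProduct, lintegral_dirac' _ hFm, lintegral_atomLaw _ _ _ hF]
    simp only [Finset.univ_eq_empty, Finset.sum_empty, add_zero]
    have hF1 : Measurable fun p : Measure 𝓨 × (Fin 0 → ℝ) => F p.1 := hF.comp measurable_fst
    rw [lintegral_prod _ hF1.aemeasurable]
    simp
  | succ n ih =>
    have hm := measurable_atomLaw 𝒢 (e := fun _ : Fin (n + 1) => 1) (by simp)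
    have hFm : Measurable fun y => ∫⁻ μ, F μ ∂(_root_.atomLaw 𝒢 (fun _ : Fin (n + 1) => 1) y) :=
      (Measure.measurable_lintegral hF).comp hm
    rw [lintegral_urnProduct_succ _ _ hFm]
    -- Given the first `n` values, the next one is drawn from exactly the shape measure of the
    -- current Gamma law. The Palm formula for that shape yields one factor `T`, which the induction
    -- hypothesis absorbs into the test function.
    have e : ∀ y : Fin n → 𝓨, ∫⁻ z, ∫⁻ μ, F μ
        ∂(_root_.atomLaw 𝒢 (fun _ : Fin (n + 1) => 1) (Fin.snoc y z : Fin (n + 1) → 𝓨))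
          ∂(α + ∑ i, Measure.dirac (y i)) =
        ∫⁻ μ, μ Set.univ * F μ ∂(_root_.atomLaw 𝒢 (fun _ : Fin n => 1) y) := by
      intro y
      have h1 := h.atomLaw (e := fun _ : Fin n => 1) (by simp) y
      simp only [ENNReal.ofReal_one, one_smul] at h1
      refine h1.lintegral_total_mul (K := fun z => _root_.atomLaw 𝒢 (fun _ : Fin (n + 1) => 1)
        (Fin.snoc y z : Fin (n + 1) → 𝓨)) (hm.comp ((measurable_snoc n).comp
          measurable_prodMk_left)) (fun z => ?_) hF
      have h2 := h.atomLaw (e := fun _ : Fin (n + 1) => 1) (by simp)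
        (Fin.snoc y z : Fin (n + 1) → 𝓨)
      simpa [Fin.sum_univ_castSucc, add_assoc] using h2
    simp_rw [e]
    rw [ih (F := fun μ => μ Set.univ * F μ) (hU.mul hF)]
    refine lintegral_congr fun μ => ?_
    rw [pow_succ, mul_assoc]

end Urn

/-! ### Tie patterns of the urn sequence with nonatomic base measure. -/

section Ties

/-- The sequences whose ties are those of the labelling `f`. -/
def tieSet (𝓨 : Type*) {n k : ℕ} (f : Fin n → Fin k) : Set (Fin n → 𝓨) :=
  {y | ∀ i j, y i = y j ↔ f i = f j}

lemma mem_tieSet {𝓨 : Type*} {n k : ℕ} {f : Fin n → Fin k} {y : Fin n → 𝓨} :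
    y ∈ tieSet 𝓨 f ↔ ∀ i j, y i = y j ↔ f i = f j := Iff.rfl

/-- The recursive form of a tie pattern, matched to the urn: only the comparison of the new draw
with the earlier ones is added. -/
lemma snoc_mem_tieSet {𝓨 : Type*} {n k : ℕ} {f : Fin (n + 1) → Fin k} {y : Fin n → 𝓨} {z : 𝓨} :
    (Fin.snoc y z : Fin (n + 1) → 𝓨) ∈ tieSet 𝓨 f ↔
      y ∈ tieSet 𝓨 (fun i => f i.castSucc) ∧ ∀ i, z = y i ↔ f i.castSucc = f (Fin.last n) := by
  simp only [mem_tieSet]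
  constructor
  · intro h
    refine ⟨fun i j => by simpa using h i.castSucc j.castSucc, fun i => ?_⟩
    have := h i.castSucc (Fin.last n)
    simp only [Fin.snoc_castSucc, Fin.snoc_last] at this
    rw [← this, eq_comm]
  · rintro ⟨h1, h2⟩ i j
    refine Fin.lastCases ?_ (fun i => ?_) i <;> refine Fin.lastCases ?_ (fun j => ?_) j
    · simp
    · simp only [Fin.snoc_castSucc, Fin.snoc_last]
      rw [h2, eq_comm]
    · simp only [Fin.snoc_castSucc, Fin.snoc_last]
      rw [eq_comm, h2]
    · simpa using h1 i j

/-- The number of indices carrying the label `c`. -/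
def labelCard {n k : ℕ} (f : Fin n → Fin k) (c : Fin k) : ℕ :=
  (Finset.univ.filter fun i => f i = c).card

lemma labelCard_succ {n k : ℕ} (f : Fin (n + 1) → Fin k) (c : Fin k) :
    labelCard f c = labelCard (fun i => f i.castSucc) c + if f (Fin.last n) = c then 1 else 0 := by
  simp only [labelCard, Finset.card_filter, Fin.sum_univ_castSucc]

variable {𝓨 : Type*} [MeasurableSpace 𝓨] [MeasurableEq 𝓨]

lemma measurableSet_tieSet {n k : ℕ} (f : Fin n → Fin k) : MeasurableSet (tieSet 𝓨 f) := by
  have e : tieSet 𝓨 f = ⋂ i, ⋂ j, {y | y i = y j ↔ f i = f j} := by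
    ext y
    simp [mem_tieSet]
  rw [e]
  refine MeasurableSet.iInter fun i => MeasurableSet.iInter fun j => ?_
  have h : MeasurableSet {y : Fin n → 𝓨 | y i = y j} :=
    measurableSet_eq_fun (measurable_pi_apply i) (measurable_pi_apply j)
  by_cases hf : f i = f j
  · simpa [hf] using h
  · simp only [hf, iff_false]
    exact h.compl

/-- The law of the urn sequence with nonatomic shape measure, restricted to a given tie pattern. -/
theorem lintegral_urnProduct_tieSet (H : Measure 𝓨) [IsProbabilityMeasure H]
    [NullSingletonClass H] (a : ℝ≥0∞) (ha : a ≠ ⊤) (n : ℕ) :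
    ∀ {k : ℕ} (f : Fin n → Fin k) (s : Fin k → Fin n) (_ : ∀ c, f (s c) = c)
      {F : (Fin k → 𝓨) → ℝ≥0∞} (_ : Measurable F),
      ∫⁻ y, (tieSet 𝓨 f).indicator (fun y => F fun c => y (s c)) y ∂urnProduct (a • H) n =
        (a ^ k * ∏ c, ((labelCard f c - 1).factorial : ℝ≥0∞)) *
          ∫⁻ z, F z ∂Measure.pi fun _ => H := by
  have : IsFiniteMeasure (a • H) := Measure.smul_finite _ ha
  induction n with
  | zero =>
    intro k f s hs F hF
    obtain rfl : k = 0 := by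
      rcases k with _ | k
      · rfl
      · exact (s 0).elim0
    have hm : ∀ y : Fin 0 → 𝓨, y ∈ tieSet 𝓨 f := fun y i => i.elim0
    rw [urnProduct, lintegral_dirac' _ ((by fun_prop : Measurable fun y : Fin 0 → 𝓨 =>
      F fun c => y (s c)).indicator (measurableSet_tieSet f)), Set.indicator_of_mem (hm _),
      Measure.pi_of_empty, lintegral_dirac' _ hF]
    simp only [pow_zero, Finset.univ_eq_empty, Finset.prod_empty, one_mul]
    congr 1
  | succ n ih =>
    intro k f s hs F hF
    rw [lintegral_urnProduct_succ _ _ ((by fun_prop : Measurable fun y : Fin (n + 1) → 𝓨 =>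
      F fun c => y (s c)).indicator (measurableSet_tieSet f))]
    -- Either the last draw joins a label already present, or it opens a new one. The section `s` of
    -- `f` forces every label to be used.
    by_cases hc : ∃ j : Fin n, f j.castSucc = f (Fin.last n)
    · obtain ⟨j, hj⟩ := hc
      have hsur : ∀ c, ∃ i : Fin n, f i.castSucc = c := by
        intro c
        rcases Fin.eq_castSucc_or_eq_last (s c) with ⟨i, hi⟩ | hi
        · exact ⟨i, by rw [← hi, hs]⟩
        · exact ⟨j, by rw [hj, ← hi, hs]⟩
      choose s' hs' using hsur
      have e1 : ∀ y : Fin n → 𝓨, ∀ z, (tieSet 𝓨 f).indicator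
          (fun y : Fin (n + 1) → 𝓨 => F fun c => y (s c)) (Fin.snoc y z : Fin (n + 1) → 𝓨) =
          (tieSet 𝓨 fun i => f i.castSucc).indicator (fun y => F fun c => y (s' c)) y *
            ({y j} : Set 𝓨).indicator 1 z := by
        intro y z
        have hiff : (Fin.snoc y z : Fin (n + 1) → 𝓨) ∈ tieSet 𝓨 f ↔
            y ∈ tieSet 𝓨 (fun i => f i.castSucc) ∧ z = y j := by
          rw [snoc_mem_tieSet]
          refine and_congr_right fun hy => ⟨fun h => (h j).2 hj, fun h i => ?_⟩
          have := hy j i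
          simp only [hj] at this
          rw [h, this, eq_comm]
        by_cases hm : (Fin.snoc y z : Fin (n + 1) → 𝓨) ∈ tieSet 𝓨 f
        · obtain ⟨hy, hz⟩ := hiff.1 hm
          rw [Set.indicator_of_mem hm, Set.indicator_of_mem hy,
            Set.indicator_of_mem (by simpa using hz), Pi.one_apply, mul_one]
          congr 1
          funext c
          -- The representative `s c` may be the last index; on the tie set it can be traded for an
          -- earlier index with the same label.
          have := (hm (s c) (s' c).castSucc).2 (by rw [hs, hs'])
          rw [this, Fin.snoc_castSucc]
        · rw [Set.indicator_of_notMem hm]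
          by_cases hy : y ∈ tieSet 𝓨 (fun i => f i.castSucc)
          · rw [Set.indicator_of_notMem (s := {y j}) (fun hz => hm (hiff.2 ⟨hy, hz⟩)), mul_zero]
          · rw [Set.indicator_of_notMem hy, zero_mul]
      have e2 : ∀ y : Fin n → 𝓨, ∫⁻ z, (tieSet 𝓨 f).indicator
          (fun y : Fin (n + 1) → 𝓨 => F fun c => y (s c)) (Fin.snoc y z : Fin (n + 1) → 𝓨)
            ∂(a • H + ∑ i, Measure.dirac (y i)) =
          (labelCard (fun i => f i.castSucc) (f (Fin.last n)) : ℝ≥0∞) *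
            (tieSet 𝓨 fun i => f i.castSucc).indicator (fun y => F fun c => y (s' c)) y := by
        intro y
        simp_rw [e1]
        rw [lintegral_const_mul _ (measurable_one.indicator (measurableSet_singleton _)),
          lintegral_indicator_one (measurableSet_singleton _)]
        by_cases hy : y ∈ tieSet 𝓨 (fun i => f i.castSucc)
        · rw [mul_comm]
          congr 1
          -- `H` does not charge the point `y j`, so its mass is the number of earlier draws tied
          -- with it.
          rw [Measure.add_apply, Measure.smul_apply, measure_singleton, smul_zero, zero_add,
            Measure.finsetSum_apply, labelCard, Finset.card_filter, Nat.cast_sum]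
          refine Finset.sum_congr rfl fun i _ => ?_
          rw [Measure.dirac_apply' _ (measurableSet_singleton _), ← hj]
          by_cases hi : y i = y j
          · rw [Set.indicator_of_mem (by simpa using hi), if_pos ((hy i j).1 hi)]
            simp
          · rw [Set.indicator_of_notMem (by simpa using hi), if_neg (mt (hy i j).2 hi)]
            simp
        · rw [Set.indicator_of_notMem hy, zero_mul, mul_zero]
      simp_rw [e2]
      rw [lintegral_const_mul _ ((by fun_prop : Measurable fun y : Fin n → 𝓨 =>
        F fun c => y (s' c)).indicator (measurableSet_tieSet _)), ih _ s' hs' hF, ← mul_assoc]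
      congr 1
      rw [mul_left_comm]
      congr 1
      rw [← Finset.mul_prod_erase _ _ (Finset.mem_univ (f (Fin.last n))),
        ← Finset.mul_prod_erase _ (fun c => ((labelCard f c - 1).factorial : ℝ≥0∞))
          (Finset.mem_univ (f (Fin.last n))), ← mul_assoc]
      congr 1
      -- A label of earlier multiplicity `m` has its factor raised from `(m-1)!` to `m!`; here `m ≥
      -- 1` thanks to `j`.
      · rw [labelCard_succ f, if_pos rfl, Nat.add_sub_cancel, ← Nat.cast_mul,
          Nat.mul_factorial_pred]
        exact (Finset.card_pos.2 ⟨j, by simpa using hj⟩).ne'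
      · refine Finset.prod_congr rfl fun c hcm => ?_
        rw [labelCard_succ f, if_neg (Finset.ne_of_mem_erase hcm).symm, add_zero]
    · push Not at hc
      obtain ⟨k, rfl⟩ : ∃ m, k = m + 1 := by
        rcases k with _ | k
        · exact (f (Fin.last n)).elim0
        · exact ⟨k, rfl⟩
      -- The earlier indices never carry the new label, so skipping it with `succAbove` gives a
      -- labelling by `k` labels to which the induction applies.
      have hf' : ∀ i : Fin n, ∃ c, (f (Fin.last n)).succAbove c = f i.castSucc := fun i =>
        Fin.exists_succAbove_eq (hc i)
      choose f' hf' using hf'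
      have hsl : s (f (Fin.last n)) = Fin.last n := by
        rcases Fin.eq_castSucc_or_eq_last (s (f (Fin.last n))) with ⟨i, hi⟩ | hi
        · exact absurd (by rw [← hi, hs]) (hc i)
        · exact hi
      have hs' : ∀ c, ∃ i : Fin n, s ((f (Fin.last n)).succAbove c) = i.castSucc := by
        intro c
        rcases Fin.eq_castSucc_or_eq_last (s ((f (Fin.last n)).succAbove c)) with ⟨i, hi⟩ | hi
        · exact ⟨i, hi⟩
        · exfalso
          have := hs ((f (Fin.last n)).succAbove c)
          rw [hi] at this
          exact Fin.succAbove_ne _ _ this.symm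
      choose s' hs' using hs'
      have hfs' : ∀ c, f' (s' c) = c := fun c => by
        apply Fin.succAbove_right_injective (p := f (Fin.last n))
        rw [hf', ← hs', hs]
      have hties : ∀ y : Fin n → 𝓨, y ∈ tieSet 𝓨 (fun i => f i.castSucc) ↔ y ∈ tieSet 𝓨 f' := by
        intro y
        simp only [mem_tieSet, ← hf', Fin.succAbove_right_inj]
      have e0 : ∀ (y : Fin n → 𝓨) (z : 𝓨),
          (fun c => (Fin.snoc y z : Fin (n + 1) → 𝓨) (s c)) =
            ((f (Fin.last n)).insertNth z fun c => y (s' c) : Fin (k + 1) → 𝓨) := by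
        intro y z
        rw [Fin.eq_insertNth_iff]
        refine ⟨by rw [hsl, Fin.snoc_last], ?_⟩
        funext c
        simp only [Fin.removeNth, hs', Fin.snoc_castSucc]
      have hins : Measurable fun p : (Fin k → 𝓨) × 𝓨 =>
          ((f (Fin.last n)).insertNth p.2 p.1 : Fin (k + 1) → 𝓨) :=
        (MeasurableEquiv.piFinSuccAbove (fun _ => 𝓨) (f (Fin.last n))).symm.measurable.comp
          measurable_swap
      -- `Φ` is `F` with the coordinate of the new label integrated out against `H`; the draw is
      -- independent of the earlier values.
      obtain ⟨Φ, hΦ⟩ : ∃ Φ : (Fin k → 𝓨) → ℝ≥0∞, ∀ w, Φ w =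
          ∫⁻ z, F ((f (Fin.last n)).insertNth z w : Fin (k + 1) → 𝓨) ∂H := ⟨_, fun _ => rfl⟩
      have hΦm : Measurable Φ := by
        have := Measurable.lintegral_prod_right' (ν := H) (f := fun p : (Fin k → 𝓨) × 𝓨 =>
          F ((f (Fin.last n)).insertNth p.2 p.1 : Fin (k + 1) → 𝓨)) (hF.comp hins)
        rwa [← funext hΦ] at this
      have e2 : ∀ y : Fin n → 𝓨, ∫⁻ z, (tieSet 𝓨 f).indicator
          (fun y : Fin (n + 1) → 𝓨 => F fun c => y (s c)) (Fin.snoc y z : Fin (n + 1) → 𝓨)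
            ∂(a • H + ∑ i, Measure.dirac (y i)) =
          a * (tieSet 𝓨 f').indicator (fun y => Φ fun c => y (s' c)) y := by
        intro y
        rw [lintegral_add_measure, lintegral_finsetSum_measure, lintegral_smul_measure,
          Finset.sum_eq_zero, add_zero, smul_eq_mul]
        · congr 1
          by_cases hy : y ∈ tieSet 𝓨 f'
          · rw [Set.indicator_of_mem hy, hΦ]
            refine lintegral_congr_ae ?_
            -- Without atoms, a draw from `H` almost surely avoids the finitely many earlier values.
            -- The atoms of the urn contribute nothing, since they would create a tie.
            filter_upwards [(Set.finite_range y).countable.ae_notMem H] with z hz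
            rw [Set.indicator_of_mem, e0]
            rw [snoc_mem_tieSet, hties]
            exact ⟨hy, fun i => iff_of_false (fun h => hz ⟨i, h.symm⟩) (hc i)⟩
          · rw [Set.indicator_of_notMem hy]
            refine (lintegral_congr fun z => ?_).trans lintegral_zero
            refine Set.indicator_of_notMem (fun h => hy ?_) _
            exact (hties y).1 (snoc_mem_tieSet.1 h).1
        · intro i _
          rw [lintegral_dirac, Set.indicator_of_notMem]
          intro h
          exact hc i (((snoc_mem_tieSet.1 h).2 i).1 rfl)
      simp_rw [e2]
      rw [lintegral_const_mul _ ((by fun_prop : Measurable fun y : Fin n → 𝓨 =>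
        Φ fun c => y (s' c)).indicator (measurableSet_tieSet _)), ih f' s' hfs' hΦm]
      have hpi : ∫⁻ z, F z ∂(Measure.pi fun _ : Fin (k + 1) => H) =
          ∫⁻ w, Φ w ∂(Measure.pi fun _ : Fin k => H) := by
        simp_rw [hΦ]
        rw [← ((measurePreserving_piFinSuccAbove (fun _ : Fin (k + 1) => H)
          (f (Fin.last n))).symm).lintegral_comp hF, lintegral_prod_symm]
        · rfl
        · exact (hF.comp (MeasurableEquiv.measurable _)).aemeasurable
      rw [hpi, ← mul_assoc]
      congr 1
      rw [Fin.prod_univ_succAbove _ (f (Fin.last n)), pow_succ', mul_assoc]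
      congr 2
      have h0 : labelCard (fun i => f i.castSucc) (f (Fin.last n)) = 0 := by
        rw [labelCard, Finset.card_eq_zero, Finset.filter_eq_empty_iff]
        exact fun i _ => hc i
      rw [labelCard_succ f, if_pos rfl, h0]
      simp only [zero_add, Nat.sub_self, Nat.factorial_zero, Nat.cast_one, one_mul]
      refine Finset.prod_congr rfl fun c _ => ?_
      rw [labelCard_succ f, if_neg (Fin.succAbove_ne _ _).symm, add_zero]
      simp only [labelCard, ← hf', Fin.succAbove_right_inj]

end Ties

/-! ### From labellings to partitions: the Ewens distribution. -/

section Partitions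

variable {n : ℕ}

/-- The labelling of the indices by the cells of a partition. -/
noncomputable def partLabel (p : Finpartition (Finset.univ : Finset (Fin n))) (i : Fin n) :
    Fin p.parts.card :=
  p.parts.equivFin ⟨p.part i, p.part_mem.2 (Finset.mem_univ i)⟩

lemma partLabel_eq_iff (p : Finpartition (Finset.univ : Finset (Fin n))) (i : Fin n)
    (C : p.parts) : partLabel p i = p.parts.equivFin C ↔ i ∈ C.1 := by
  rw [partLabel, EmbeddingLike.apply_eq_iff_eq, Subtype.ext_iff, p.part_eq_iff_mem C.2]

lemma partLabel_eq_partLabel_iff (p : Finpartition (Finset.univ : Finset (Fin n)))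
    (i j : Fin n) : partLabel p i = partLabel p j ↔ p.part i = p.part j := by
  rw [partLabel, partLabel, EmbeddingLike.apply_eq_iff_eq, Subtype.ext_iff]

lemma labelCard_partLabel (p : Finpartition (Finset.univ : Finset (Fin n))) (C : p.parts) :
    labelCard (partLabel p) (p.parts.equivFin C) = C.1.card := by
  rw [labelCard]
  congr 1
  ext i
  simp [partLabel_eq_iff]

lemma Finpartition.ext_of_part {p p' : Finpartition (Finset.univ : Finset (Fin n))}
    (h : ∀ i, p.part i = p'.part i) : p = p' := by
  have key : ∀ p : Finpartition (Finset.univ : Finset (Fin n)),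
      p.parts = Finset.univ.image p.part := by
    intro p
    ext C
    simp only [Finset.mem_image, Finset.mem_univ, true_and]
    constructor
    · intro hC
      obtain ⟨i, hi⟩ := p.nonempty_of_mem_parts hC
      exact ⟨i, p.part_eq_of_mem hC hi⟩
    · rintro ⟨i, rfl⟩
      exact p.part_mem.2 (Finset.mem_univ i)
  ext1
  rw [key p, key p', funext h]

variable {𝓨 : Type*}

lemma mem_part_tiePartition (y : Fin n → 𝓨) (i j : Fin n) :
    j ∈ (tiePartition y).part i ↔ y i = y j := by
  classical
  exact Finpartition.mem_part_ofSetoid_iff_rel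

/-- Both sides say that ties occur exactly within the cells; this transfers the measure computed for
labellings to partitions. -/
lemma tiePartition_eq_iff (y : Fin n → 𝓨) (p : Finpartition (Finset.univ : Finset (Fin n))) :
    tiePartition y = p ↔ y ∈ tieSet 𝓨 (partLabel p) := by
  have hp : ∀ (p : Finpartition (Finset.univ : Finset (Fin n))) i j,
      j ∈ p.part i ↔ p.part i = p.part j := fun p i j => by
    rw [p.mem_part_iff_part_eq_part (Finset.mem_univ _) (Finset.mem_univ _), eq_comm]
  simp only [mem_tieSet, partLabel_eq_partLabel_iff]
  constructor
  · rintro rfl i j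
    rw [← mem_part_tiePartition, hp]
  · intro h
    refine Finpartition.ext_of_part fun i => ?_
    ext j
    rw [mem_part_tiePartition, h, hp]

lemma eq_cellValue {y : Fin n → 𝓨} {p : Finpartition (Finset.univ : Finset (Fin n))}
    (h : tiePartition y = p) (C : p.parts) {i : Fin n} (hi : i ∈ C.1) :
    y i = cellValue p C y := by
  rw [cellValue, (tiePartition_eq_iff y p).1 h, (partLabel_eq_iff p i C).2 hi,
    (partLabel_eq_iff p _ C).2 (Finset.min'_mem _ _)]

variable [MeasurableSpace 𝓨]

lemma measurable_cellValue (p : Finpartition (Finset.univ : Finset (Fin n))) :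
    Measurable fun (y : Fin n → 𝓨) (C : p.parts) => cellValue p C y := by
  unfold cellValue
  fun_prop

/-- All draws in a cell share one value, so their unit atoms pile up to mass `|C|`. Grouped and
ungrouped atoms thus give the same shape measure. -/
lemma sum_card_smul_dirac_cellValue {y : Fin n → 𝓨}
    {p : Finpartition (Finset.univ : Finset (Fin n))} (h : tiePartition y = p) :
    ∑ C : p.parts, ENNReal.ofReal (C.1.card : ℝ) • Measure.dirac (cellValue p C y) =
      ∑ i, Measure.dirac (y i) := by
  have h1 : ∀ C : p.parts, ENNReal.ofReal (C.1.card : ℝ) • Measure.dirac (cellValue p C y) =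
      ∑ i ∈ C.1, Measure.dirac (y i) := by
    intro C
    rw [Finset.sum_congr rfl fun i hi => by rw [eq_cellValue h C hi], Finset.sum_const,
      ENNReal.ofReal_natCast, Nat.cast_smul_eq_nsmul]
  rw [Finset.sum_congr rfl fun C _ => h1 C]
  rw [Finset.sum_coe_sort p.parts (fun C => ∑ i ∈ C, Measure.dirac (y i))]
  conv_rhs => rw [← p.sup_parts]
  rw [Finset.sup_eq_biUnion, Finset.sum_biUnion p.disjoint]
  rfl

variable [MeasurableEq 𝓨]

lemma measurableSet_tiePartition_eq (p : Finpartition (Finset.univ : Finset (Fin n))) :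
    MeasurableSet {y : Fin n → 𝓨 | tiePartition y = p} := by
  simp only [tiePartition_eq_iff]
  exact measurableSet_tieSet _

/-- Under the Blackwell–MacQueen distribution with nonatomic `H` the tie partition has the Ewens
distribution and, given the partition, the values on the cells are i.i.d. with law `H`. -/
theorem lintegral_blackwellMacQueen_tiePartition (H : Measure 𝓨) [IsProbabilityMeasure H]
    [NullSingletonClass H] {θ : ℝ} (hθ : 0 < θ)
    (p : Finpartition (Finset.univ : Finset (Fin n)))
    {F : (p.parts → 𝓨) → ℝ≥0∞} (hF : Measurable F) :
    ∫⁻ y, {y | tiePartition y = p}.indicator (fun y => F fun C => cellValue p C y) y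
        ∂blackwellMacQueen θ H n =
      ENNReal.ofReal (ewensWeight θ p) * ∫⁻ z, F z ∂Measure.pi fun _ => H := by
  have hG := Real.Gamma_pos_of_pos hθ
  have hGn : 0 < Real.Gamma (θ + n) := Real.Gamma_pos_of_pos (by positivity)
  let e := p.parts.equivFin
  have hre : Measurable fun (z : Fin p.parts.card → 𝓨) (C : p.parts) => z (e C) := by fun_prop
  -- The section of the labelling is the least index of each cell, the choice built into
  -- `cellValue`.
  have hs : ∀ c, partLabel p ((e.symm c).1.min' (p.nonempty_of_mem_parts (e.symm c).2)) = c := by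
    intro c
    rw [(partLabel_eq_iff p _ (e.symm c)).2 (Finset.min'_mem _ _)]
    exact e.apply_symm_apply c
  have key := lintegral_urnProduct_tieSet H (ENNReal.ofReal θ) ENNReal.ofReal_ne_top n
    (partLabel p) _ hs (hF.comp hre)
  have hset : {y : Fin n → 𝓨 | tiePartition y = p} = tieSet 𝓨 (partLabel p) := by
    ext y
    exact tiePartition_eq_iff y p
  have hFe : ∀ y : Fin n → 𝓨, (F ∘ fun (z : Fin p.parts.card → 𝓨) (C : p.parts) => z (e C))
      (fun c => y ((e.symm c).1.min' (p.nonempty_of_mem_parts (e.symm c).2))) =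
      F fun C => cellValue p C y := by
    intro y
    simp only [Function.comp_apply, e.symm_apply_apply]
    rfl
  simp only [hFe] at key
  rw [blackwellMacQueen, lintegral_smul_measure, hset, key, smul_eq_mul, ← mul_assoc]
  congr 1
  · rw [← Equiv.prod_comp e]
    simp only [e, labelCard_partLabel]
    rw [Finset.prod_coe_sort p.parts (fun C => ((C.card - 1).factorial : ℝ≥0∞)), ewensWeight,
      ENNReal.ofReal_mul (by positivity), ENNReal.ofReal_prod_of_nonneg (fun _ _ => by positivity)]
    simp only [ENNReal.ofReal_natCast]
    rw [← mul_assoc, ← ENNReal.ofReal_pow hθ.le, ← ENNReal.ofReal_mul (by positivity)]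
    congr 2
    ring
  · have hmp := measurePreserving_piCongrLeft (fun _ : p.parts => H) e.symm
    rw [← hmp.lintegral_comp hF]
    refine lintegral_congr fun z => ?_
    simp only [Function.comp_apply]
    congr 1
    funext C
    conv_rhs => rw [← e.symm_apply_apply C]
    exact (MeasurableEquiv.piCongrLeft_apply_apply (β := fun _ : p.parts => 𝓨) e.symm z (e C)).symm

lemma ewensWeight_pos {θ : ℝ} (hθ : 0 < θ) (p : Finpartition (Finset.univ : Finset (Fin n))) :
    0 < ewensWeight θ p := by
  have hG := Real.Gamma_pos_of_pos hθ
  have hGn : 0 < Real.Gamma (θ + n) := Real.Gamma_pos_of_pos (by positivity)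
  have : 0 < ∏ C ∈ p.parts, ((C.card - 1).factorial : ℝ) :=
    Finset.prod_pos fun C _ => by positivity
  unfold ewensWeight
  positivity

/-- The Ewens distribution of the tie partition, and the conditional law of the cell values. -/
theorem tiePartition_law {Ω : Type*} [MeasurableSpace Ω] (Pr : Measure Ω)
    [IsProbabilityMeasure Pr] (H : Measure 𝓨) [IsProbabilityMeasure H] [NullSingletonClass H]
    {θ : ℝ} (hθ : 0 < θ) {Y : Ω → Fin n → 𝓨} (hY : Measurable Y)
    (hYl : HasLaw Y (blackwellMacQueen θ H n) Pr)
    (p : Finpartition (Finset.univ : Finset (Fin n))) :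
    Pr {ω | tiePartition (Y ω) = p} = ENNReal.ofReal (ewensWeight θ p) ∧
      HasLaw (fun ω => fun C : p.parts => cellValue p C (Y ω))
        (Measure.pi fun _ : p.parts => H) (Pr[|{ω | tiePartition (Y ω) = p}]) := by
  have hS : MeasurableSet {ω | tiePartition (Y ω) = p} := hY (measurableSet_tiePartition_eq p)
  have hX : Measurable fun ω => fun C : p.parts => cellValue p C (Y ω) :=
    (measurable_cellValue p).comp hY
  -- The joint probability is the Ewens weight times the product measure. The whole space gives the
  -- law of the partition, and dividing by its positive weight gives the conditional law.
  have key : ∀ B : Set (p.parts → 𝓨), MeasurableSet B →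
      Pr ({ω | tiePartition (Y ω) = p} ∩ (fun ω => fun C : p.parts => cellValue p C (Y ω)) ⁻¹' B) =
        ENNReal.ofReal (ewensWeight θ p) * (Measure.pi fun _ : p.parts => H) B := by
    intro B hB
    have h1 := lintegral_blackwellMacQueen_tiePartition H hθ p
      (F := B.indicator 1) (measurable_one.indicator hB)
    have hm : Measurable ({y : Fin n → 𝓨 | tiePartition y = p}.indicator
        (fun y => (B.indicator 1 : (p.parts → 𝓨) → ℝ≥0∞) fun C => cellValue p C y)) :=
      ((measurable_one.indicator hB).comp (measurable_cellValue p)).indicator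
        (measurableSet_tiePartition_eq p)
    rw [lintegral_indicator_one hB, ← hYl.lintegral_comp hm.aemeasurable] at h1
    rw [← h1, ← lintegral_indicator_one (hS.inter (hX hB))]
    refine lintegral_congr fun ω => ?_
    simp only [Set.indicator, Set.mem_inter_iff, Set.mem_ofPred_eq, Set.mem_preimage]
    by_cases h1 : tiePartition (Y ω) = p <;>
      by_cases h2 : (fun C : p.parts => cellValue p C (Y ω)) ∈ B <;> simp [h1, h2]
  have hP : Pr {ω | tiePartition (Y ω) = p} = ENNReal.ofReal (ewensWeight θ p) := by
    simpa using key Set.univ MeasurableSet.univ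
  refine ⟨hP, hX.aemeasurable, ?_⟩
  ext B hB
  rw [Measure.map_apply hX hB, cond_apply hS, key B hB, hP, ← mul_assoc, ENNReal.inv_mul_cancel
    (by simpa using ewensWeight_pos hθ p) ENNReal.ofReal_ne_top, one_mul]

end Partitions

/-! ### Beta multiples of urn mixtures, and products with Gamma variables. -/

section Representation

variable {𝓨 : Type*} [MeasurableSpace 𝓨]

lemma ofReal_smul_real_univ (H : Measure 𝓨) [IsProbabilityMeasure H] {θ : ℝ} (hθ : 0 ≤ θ) :
    (ENNReal.ofReal θ • H).real Set.univ = θ := by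
  simp [hθ]

/-- The density `T^n` produced by the urn, once normalized, is that of the Beta-Gamma law with `d =
-n`, which is `θ - q` for `q = θ + n`. -/
lemma lintegral_blackwellMacQueen_atomLaw (H : Measure 𝓨) [IsProbabilityMeasure H] {θ : ℝ}
    {𝒢 : Measure (Measure 𝓨)} (h𝒢 : IsGammaLaw (ENNReal.ofReal θ • H) 𝒢) (n : ℕ)
    {F : Measure 𝓨 → ℝ≥0∞} (hF : Measurable F) :
    ∫⁻ y, ∫⁻ μ, F μ ∂(atomLaw 𝒢 (fun _ : Fin n => 1) y) ∂blackwellMacQueen θ H n =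
      ∫⁻ μ, F μ ∂betaGammaLaw θ (θ - (θ + n)) 𝒢 := by
  have : IsFiniteMeasure (ENNReal.ofReal θ • H) := Measure.smul_finite _ ENNReal.ofReal_ne_top
  have hU : Measurable fun μ : Measure 𝓨 => μ Set.univ :=
    Measure.measurable_coe MeasurableSet.univ
  have e : betaGammaLaw θ (θ - (θ + n)) 𝒢 =
      𝒢.withDensity fun μ => ENNReal.ofReal (Real.Gamma θ / Real.Gamma (θ + n)) *
        (μ Set.univ) ^ n := by
    rw [betaGammaLaw]
    congr 1
    funext μ
    rw [sub_sub_cancel, show -(θ - (θ + n)) = (n : ℝ) by ring, ENNReal.rpow_natCast]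
  rw [e, blackwellMacQueen, lintegral_smul_measure, h𝒢.lintegral_urnProduct n hF,
    lintegral_withDensity_eq_lintegral_mul _ ((hU.pow_const n).const_mul _) hF, smul_eq_mul,
    ← lintegral_const_mul _ (f := fun μ : Measure 𝓨 => μ Set.univ ^ n * F μ)
      ((hU.pow_const n).mul hF)]
  refine lintegral_congr fun μ => ?_
  simp only [Pi.mul_apply]
  ring

/-- A Beta-Gamma law is a Beta multiple of the urn mixture of Gamma laws. -/
theorem lintegral_beta_blackwellMacQueen (H : Measure 𝓨) [IsProbabilityMeasure H] {θ q : ℝ}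
    (hθ : 0 < θ) (hq : 0 < q) {𝒢 : Measure (Measure 𝓨)}
    (h𝒢 : IsGammaLaw (ENNReal.ofReal θ • H) 𝒢) (n : ℕ) (hn : 0 < θ + n - q)
    {F : Measure 𝓨 → ℝ≥0∞} (hF : Measurable F) :
    ∫⁻ u, ∫⁻ y, ∫⁻ μ, F (ENNReal.ofReal u • μ) ∂(atomLaw 𝒢 (fun _ : Fin n => 1) y)
        ∂blackwellMacQueen θ H n ∂betaMeasure q (θ + n - q) =
      ∫⁻ μ, F μ ∂betaGammaLaw θ (θ - q) 𝒢 := by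
  have : IsFiniteMeasure (ENNReal.ofReal θ • H) := Measure.smul_finite _ ENNReal.ofReal_ne_top
  have hp := h𝒢.isProbabilityMeasure
  have hα := ofReal_smul_real_univ H hθ.le
  have hθn : 0 < θ + n := by positivity
  have := isProbabilityMeasure_gammaMeasure hθn one_pos
  have := isProbabilityMeasure_gammaMeasure hq one_pos
  have := isProbabilityMeasureBeta hq hn
  have hN := measurable_normalizeMeasure (𝓨 := 𝓨)
  have hS := measurable_ofReal_smul_measure (𝓨 := 𝓨)
  have := Measure.isProbabilityMeasure_map (μ := 𝒢) hN.aemeasurable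
  have hFS : Measurable fun p : ℝ × Measure 𝓨 => F (ENNReal.ofReal p.1 • p.2) := hF.comp hS
  -- The urn mixture has `d = -n`, so it is the law of `T_{θ+n} P` with independent factors.
  have e1 : ∀ u : ℝ, ∫⁻ y, ∫⁻ μ, F (ENNReal.ofReal u • μ)
      ∂(atomLaw 𝒢 (fun _ : Fin n => 1) y) ∂blackwellMacQueen θ H n =
      ∫⁻ P, ∫⁻ t, F (ENNReal.ofReal (u * t) • P) ∂gammaMeasure (θ + n) 1
        ∂𝒢.map normalizeMeasure := by
    intro u
    have hFu : Measurable fun μ : Measure 𝓨 => F (ENNReal.ofReal u • μ) :=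
      hF.comp (measurable_const_smul_measure _)
    have hFuS : Measurable fun p : ℝ × Measure 𝓨 =>
        F (ENNReal.ofReal u • ENNReal.ofReal p.1 • p.2) := hFu.comp hS
    rw [lintegral_blackwellMacQueen_atomLaw H h𝒢 n hFu, h𝒢.betaGammaLaw_eq hθ hθn hα,
      lintegral_map hFu hS, lintegral_prod_symm _ hFuS.aemeasurable]
    refine lintegral_congr fun P => lintegral_congr_ae ?_
    filter_upwards [ae_gammaMeasure_pos (θ + n) 1] with t ht
    rw [smul_smul, ENNReal.ofReal_mul' ht.le]
  simp_rw [e1]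
  have hF3 : Measurable fun p : (ℝ × Measure 𝓨) × ℝ =>
      F (ENNReal.ofReal (p.1.1 * p.2) • p.1.2) :=
    hFS.comp (((measurable_fst.comp measurable_fst).mul measurable_snd).prodMk
      (measurable_snd.comp measurable_fst))
  rw [lintegral_lintegral_swap
    (f := fun u P => ∫⁻ t, F (ENNReal.ofReal (u * t) • P) ∂gammaMeasure (θ + n) 1)
    (Measurable.lintegral_prod_right' hF3).aemeasurable,
    h𝒢.betaGammaLaw_eq hθ hq hα, lintegral_map hF hS, lintegral_prod_symm _ hFS.aemeasurable]
  refine lintegral_congr fun P => ?_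
  -- For fixed `P` only `U T_{θ+n}` is left, which is Gamma(q) because `q + (θ + n - q) = θ + n`.
  have := lintegral_betaMeasure_gammaMeasure hq hn (F := fun x => F (ENNReal.ofReal x • P))
    (hFS.comp measurable_prodMk_right)
  rwa [add_sub_cancel] at this

/-- The law of `T_q P_θ` is the Beta-Gamma law. -/
theorem hasLaw_gamma_smul_dirichlet {Ω : Type*} [MeasurableSpace Ω] (Pr : Measure Ω)
    (H : Measure 𝓨) [IsProbabilityMeasure H] {θ q : ℝ} (hθ : 0 < θ) (hq : 0 < q)
    {𝒢 : Measure (Measure 𝓨)} (h𝒢 : IsGammaLaw (ENNReal.ofReal θ • H) 𝒢)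
    {𝒟 : Measure (Measure 𝓨)} (h𝒟 : IsDirichletLaw (ENNReal.ofReal θ • H) 𝒟)
    {T : Ω → ℝ} {P : Ω → Measure 𝓨}
    (hTP : HasLaw (fun ω => (T ω, P ω)) ((gammaMeasure q 1).prod 𝒟) Pr) :
    HasLaw (fun ω => ENNReal.ofReal (T ω) • P ω) (betaGammaLaw θ (θ - q) 𝒢) Pr := by
  have : IsFiniteMeasure (ENNReal.ofReal θ • H) := Measure.smul_finite _ ENNReal.ofReal_ne_top
  have hα := ofReal_smul_real_univ H hθ.le
  have hS := measurable_ofReal_smul_measure (𝓨 := 𝓨)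
  -- Every Dirichlet law with this shape is that of the normalized Gamma process, so the polar form
  -- of the Beta-Gamma law applies.
  rw [h𝒟.unique (h𝒢.isDirichletLaw (hα.symm ▸ hθ))] at hTP
  have hSl : HasLaw (fun p : ℝ × Measure 𝓨 => ENNReal.ofReal p.1 • p.2)
      (betaGammaLaw θ (θ - q) 𝒢) ((gammaMeasure q 1).prod (𝒢.map normalizeMeasure)) :=
    ⟨hS.aemeasurable, (h𝒢.betaGammaLaw_eq hθ hq hα).symm⟩
  exact hSl.fun_comp hTP

/-- `T_a μ_{θ,θ-b}` and `T_b μ_{θ,θ-a}` have the same law. -/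
lemma map_gamma_smul_betaGammaLaw_comm (H : Measure 𝓨) [IsProbabilityMeasure H] {θ a b : ℝ}
    (hθ : 0 < θ) (ha : 0 < a) (hb : 0 < b) {𝒢 : Measure (Measure 𝓨)}
    (h𝒢 : IsGammaLaw (ENNReal.ofReal θ • H) 𝒢) :
    ((gammaMeasure a 1).prod (betaGammaLaw θ (θ - b) 𝒢)).map
        (fun p => ENNReal.ofReal p.1 • p.2) =
      ((gammaMeasure b 1).prod (betaGammaLaw θ (θ - a) 𝒢)).map
        (fun p => ENNReal.ofReal p.1 • p.2) := by
  have : IsFiniteMeasure (ENNReal.ofReal θ • H) := Measure.smul_finite _ ENNReal.ofReal_ne_top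
  have hp := h𝒢.isProbabilityMeasure
  have hα := ofReal_smul_real_univ H hθ.le
  have := isProbabilityMeasure_gammaMeasure ha one_pos
  have := isProbabilityMeasure_gammaMeasure hb one_pos
  have hN := measurable_normalizeMeasure (𝓨 := 𝓨)
  have hS := measurable_ofReal_smul_measure (𝓨 := 𝓨)
  have := Measure.isProbabilityMeasure_map (μ := 𝒢) hN.aemeasurable
  refine Measure.ext_of_lintegral _ fun F hF => ?_
  have hFS : Measurable fun p : ℝ × Measure 𝓨 => F (ENNReal.ofReal p.1 • p.2) := hF.comp hS
  have hF3 : Measurable fun p : (ℝ × ℝ) × Measure 𝓨 =>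
      F (ENNReal.ofReal p.1.1 • ENNReal.ofReal p.1.2 • p.2) :=
    hFS.comp ((measurable_fst.comp measurable_fst).prodMk
      (hS.comp ((measurable_snd.comp measurable_fst).prodMk measurable_snd)))
  -- Both laws unfold to `T_c T_d P` with independent factors, an expression symmetric in `c` and
  -- `d`.
  have key : ∀ {c d : ℝ}, 0 < c → 0 < d →
      ∫⁻ μ, F μ ∂((gammaMeasure c 1).prod (betaGammaLaw θ (θ - d) 𝒢)).map
        (fun p => ENNReal.ofReal p.1 • p.2) =
      ∫⁻ s, ∫⁻ t, ∫⁻ P, F (ENNReal.ofReal s • ENNReal.ofReal t • P) ∂𝒢.map normalizeMeasure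
        ∂gammaMeasure d 1 ∂gammaMeasure c 1 := by
    intro c d hc hd
    have := isProbabilityMeasure_gammaMeasure hc one_pos
    have := isProbabilityMeasure_gammaMeasure hd one_pos
    have hb := h𝒢.betaGammaLaw_eq hθ hd hα
    have : IsProbabilityMeasure (betaGammaLaw θ (θ - d) 𝒢) := by
      rw [hb]
      exact Measure.isProbabilityMeasure_map hS.aemeasurable
    rw [lintegral_map hF hS, lintegral_prod _ hFS.aemeasurable]
    refine lintegral_congr fun s => ?_
    have hFs : Measurable fun μ : Measure 𝓨 => F (ENNReal.ofReal s • μ) :=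
      hF.comp (measurable_const_smul_measure _)
    have hFsS : Measurable fun p : ℝ × Measure 𝓨 =>
        F (ENNReal.ofReal s • ENNReal.ofReal p.1 • p.2) := hFs.comp hS
    rw [hb, lintegral_map hFs hS, lintegral_prod _ hFsS.aemeasurable]
  rw [key ha hb, key hb ha, lintegral_lintegral_swap
    (f := fun s t => ∫⁻ P, F (ENNReal.ofReal s • ENNReal.ofReal t • P) ∂𝒢.map normalizeMeasure)
    (Measurable.lintegral_prod_right' hF3).aemeasurable]
  simp_rw [smul_comm (ENNReal.ofReal _) (ENNReal.ofReal _)]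

/-- The random measure `U (M + T δ_Y)` has a Beta-Gamma law. -/
theorem hasLaw_beta_smul_add_atom {Ω : Type*} [MeasurableSpace Ω] (Pr : Measure Ω)
    (H : Measure 𝓨) [IsProbabilityMeasure H] {θ q : ℝ} (hθ : 0 < θ) (hq : 0 < q)
    (hθq : 0 < θ + 1 - q) {𝒢 : Measure (Measure 𝓨)}
    (h𝒢 : IsGammaLaw (ENNReal.ofReal θ • H) 𝒢)
    {U : Ω → ℝ} {M : Ω → Measure 𝓨} {T : Ω → ℝ} {Y : Ω → 𝓨}
    (h : HasLaw (fun ω => (U ω, M ω, T ω, Y ω))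
      ((betaMeasure q (θ + 1 - q)).prod (𝒢.prod ((gammaMeasure 1 1).prod H))) Pr) :
    HasLaw (fun ω => ENNReal.ofReal (U ω) • M ω +
      ENNReal.ofReal (U ω) • ENNReal.ofReal (T ω) • Measure.dirac (Y ω))
      (betaGammaLaw θ (θ - q) 𝒢) Pr := by
  have : IsFiniteMeasure (ENNReal.ofReal θ • H) := Measure.smul_finite _ ENNReal.ofReal_ne_top
  have hp := h𝒢.isProbabilityMeasure
  have := isProbabilityMeasure_gammaMeasure one_pos one_pos
  have := isProbabilityMeasureBeta hq hθq
  have hS := measurable_ofReal_smul_measure (𝓨 := 𝓨)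
  have hA : Measurable fun p : Measure 𝓨 × ℝ × 𝓨 =>
      p.1 + ENNReal.ofReal p.2.1 • Measure.dirac p.2.2 :=
    measurable_fst.add (hS.comp ((measurable_fst.comp measurable_snd).prodMk
      (Measure.measurable_dirac.comp (measurable_snd.comp measurable_snd))))
  have hX : Measurable fun p : ℝ × Measure 𝓨 × ℝ × 𝓨 => ENNReal.ofReal p.1 • p.2.1 +
      ENNReal.ofReal p.1 • ENNReal.ofReal p.2.2.1 • Measure.dirac p.2.2.2 := by
    simp_rw [← smul_add]
    exact hS.comp (measurable_fst.prodMk (hA.comp measurable_snd))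
  refine HasLaw.fun_comp (Y := fun p : ℝ × Measure 𝓨 × ℝ × 𝓨 => ENNReal.ofReal p.1 • p.2.1 +
      ENNReal.ofReal p.1 • ENNReal.ofReal p.2.2.1 • Measure.dirac p.2.2.2)
      ⟨hX.aemeasurable, ?_⟩ h
  refine Measure.ext_of_lintegral _ fun F hF => ?_
  have hn : 0 < θ + ((1 : ℕ) : ℝ) - q := by simpa using hθq
  have hFX : Measurable fun p : ℝ × Measure 𝓨 × ℝ × 𝓨 => F (ENNReal.ofReal p.1 • p.2.1 +
      ENNReal.ofReal p.1 • ENNReal.ofReal p.2.2.1 • Measure.dirac p.2.2.2) := hF.comp hX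
  rw [← lintegral_beta_blackwellMacQueen H hθ hq h𝒢 1 hn hF, Nat.cast_one, lintegral_map hF hX,
    lintegral_prod _ hFX.aemeasurable]
  refine lintegral_congr fun u => ?_
  have hFu : Measurable fun μ : Measure 𝓨 => F (ENNReal.ofReal u • μ) :=
    hF.comp (measurable_const_smul_measure _)
  have hFA : Measurable fun p : Measure 𝓨 × ℝ × 𝓨 =>
      F (ENNReal.ofReal u • (p.1 + ENNReal.ofReal p.2.1 • Measure.dirac p.2.2)) := hFu.comp hA
  simp_rw [← smul_add]
  -- For one draw the constant `Γ(θ)/Γ(θ+1) = 1/θ` cancels the mass of `θH`.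
  have hB : blackwellMacQueen θ H 1 = H.map fun z _ => z := by
    refine Measure.ext_of_lintegral _ fun G hG => ?_
    have hm : Measurable fun y : Fin 0 → 𝓨 =>
        ∫⁻ z, G (Fin.snoc y z : Fin 1 → 𝓨) ∂(ENNReal.ofReal θ • H + ∑ i, Measure.dirac (y i)) := by
      simp only [Finset.univ_eq_empty, Finset.sum_empty, add_zero]
      exact Measurable.lintegral_prod_right' (f := fun p : (Fin 0 → 𝓨) × 𝓨 =>
        G (Fin.snoc p.1 p.2 : Fin 1 → 𝓨)) (hG.comp (measurable_snoc 0))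
    have hs : ∀ (y : Fin 0 → 𝓨) (z : 𝓨), (Fin.snoc y z : Fin 1 → 𝓨) = fun _ => z := by
      intro y z
      funext i
      rw [show i = Fin.last 0 from Subsingleton.elim (α := Fin 1) _ _, Fin.snoc_last]
    have hΓ : ENNReal.ofReal (Real.Gamma θ / Real.Gamma (θ + 1)) * ENNReal.ofReal θ = 1 := by
      have := Real.Gamma_pos_of_pos hθ
      rw [Real.Gamma_add_one hθ.ne', ← ENNReal.ofReal_mul (by positivity)]
      convert ENNReal.ofReal_one using 2
      field_simp
    rw [blackwellMacQueen, lintegral_smul_measure, lintegral_urnProduct_succ _ _ hG, urnProduct,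
      lintegral_dirac' _ hm, lintegral_map hG (by fun_prop)]
    simp only [hs, Finset.univ_eq_empty, Finset.sum_empty, add_zero, lintegral_smul_measure,
      smul_eq_mul, Nat.cast_one]
    rw [← mul_assoc, hΓ, one_mul]
  have hm := measurable_atomLaw 𝒢 (e := fun _ : Fin 1 => 1) (by simp)
  have hFm : Measurable fun y => ∫⁻ μ, F (ENNReal.ofReal u • μ)
      ∂(atomLaw 𝒢 (fun _ : Fin 1 => 1) y) := (Measure.measurable_lintegral hFu).comp hm
  rw [hB, lintegral_map hFm (by fun_prop)]
  have e : ∀ z : 𝓨, ∫⁻ μ, F (ENNReal.ofReal u • μ) ∂(atomLaw 𝒢 (fun _ : Fin 1 => 1) fun _ => z) =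
      ∫⁻ μ, ∫⁻ t, F (ENNReal.ofReal u • (μ + ENNReal.ofReal t • Measure.dirac z))
        ∂gammaMeasure 1 1 ∂𝒢 := by
    intro z
    have hFz : Measurable fun p : Measure 𝓨 × ℝ =>
        F (ENNReal.ofReal u • (p.1 + ENNReal.ofReal p.2 • Measure.dirac z)) :=
      hFA.comp (measurable_fst.prodMk (measurable_snd.prodMk measurable_const))
    have hFw : Measurable fun p : Measure 𝓨 × (Fin 1 → ℝ) => F (ENNReal.ofReal u •
        (p.1 + ∑ i, ENNReal.ofReal (p.2 i) • Measure.dirac z)) :=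
      hFu.comp (measurable_add_atoms _)
    rw [lintegral_atomLaw _ _ _ hFu, lintegral_prod _ hFw.aemeasurable]
    refine lintegral_congr fun μ => ?_
    rw [← (measurePreserving_funUnique (gammaMeasure 1 1) (Fin 1)).lintegral_comp
      (f := fun t => F (ENNReal.ofReal u • (μ + ENNReal.ofReal t • Measure.dirac z)))
      (hFz.comp measurable_prodMk_left)]
    refine lintegral_congr fun w => ?_
    simp
  simp_rw [e]
  have hFA4 : Measurable fun p : (Measure 𝓨 × 𝓨) × ℝ =>
      F (ENNReal.ofReal u • (p.1.1 + ENNReal.ofReal p.2 • Measure.dirac p.1.2)) :=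
    hFA.comp ((measurable_fst.comp measurable_fst).prodMk
      (measurable_snd.prodMk (measurable_snd.comp measurable_fst)))
  rw [lintegral_prod _ hFA.aemeasurable, ← lintegral_lintegral_swap
    (f := fun μ z => ∫⁻ t, F (ENNReal.ofReal u • (μ + ENNReal.ofReal t • Measure.dirac z))
        ∂gammaMeasure 1 1) (Measurable.lintegral_prod_right' hFA4).aemeasurable]
  refine lintegral_congr fun μ => ?_
  exact lintegral_prod_symm _ (hFA.comp measurable_prodMk_left).aemeasurable

end Representation

/-! ### The representation with atoms at the distinct values. -/

section PartitionRepresentation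

variable {𝓨 : Type*} [MeasurableSpace 𝓨]

/-- The order is chosen for the conditional law given the partition: cell values outermost, the Beta
variable next, and innermost the Gamma process with its weights, which together form `atomLaw`. -/
lemma lintegral_prod_four {A B C D : Type*} [MeasurableSpace A] [MeasurableSpace B]
    [MeasurableSpace C] [MeasurableSpace D] (κ : Measure A) (ρ : Measure B) (ν : Measure C)
    (τ : Measure D) [SFinite κ] [SFinite ρ] [SFinite ν] [SFinite τ]
    {J : A × B × C × D → ℝ≥0∞} (hJ : Measurable J) :
    ∫⁻ x, J x ∂(κ.prod (ρ.prod (ν.prod τ))) =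
      ∫⁻ c, ∫⁻ a, ∫⁻ x : B × D, J (a, x.1, c, x.2) ∂(ρ.prod τ) ∂κ ∂ν := by
  have h1 : ∀ a, Measurable fun x : B × C × D => J (a, x) := fun a =>
    hJ.comp measurable_prodMk_left
  have h2 : ∀ a, Measurable fun x : (B × C) × D => J (a, x.1.1, x.1.2, x.2) := fun a =>
    hJ.comp (by fun_prop)
  have h3 : Measurable fun x : (A × C) × (B × D) => J (x.1.1, x.2.1, x.1.2, x.2.2) :=
    hJ.comp (by fun_prop)
  rw [lintegral_prod _ hJ.aemeasurable]
  have e : ∀ a, ∫⁻ x, J (a, x) ∂(ρ.prod (ν.prod τ)) =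
      ∫⁻ c, ∫⁻ x : B × D, J (a, x.1, c, x.2) ∂(ρ.prod τ) ∂ν := by
    intro a
    have h4 : ∀ c, Measurable fun x : B × D => J (a, x.1, c, x.2) := fun c =>
      hJ.comp (by fun_prop)
    have h5 : ∀ b, Measurable fun x : C × D => J (a, b, x) := fun b => hJ.comp (by fun_prop)
    rw [lintegral_prod _ (h1 a).aemeasurable]
    simp_rw [fun c => lintegral_prod (μ := ρ) (ν := τ) _ (h4 c).aemeasurable,
      fun b => lintegral_prod (μ := ν) (ν := τ) _ (h5 b).aemeasurable]
    exact lintegral_lintegral_swap (f := fun b c => ∫⁻ d, J (a, b, c, d) ∂τ)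
      (Measurable.lintegral_prod_right' (h2 a)).aemeasurable
  simp_rw [e]
  exact lintegral_lintegral_swap
    (f := fun a c => ∫⁻ x : B × D, J (a, x.1, c, x.2) ∂(ρ.prod τ))
    (Measurable.lintegral_prod_right' h3).aemeasurable

/-- A Gamma process with Gamma weighted atoms at the distinct values has the same law as the one
with exponentially weighted atoms at all values. -/
lemma atomLaw_cellValue {α : Measure 𝓨} [IsFiniteMeasure α] {𝒢 : Measure (Measure 𝓨)}
    (h : IsGammaLaw α 𝒢) {n : ℕ} {y : Fin n → 𝓨}
    {p : Finpartition (Finset.univ : Finset (Fin n))} (hy : tiePartition y = p) :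
    atomLaw 𝒢 (fun C : p.parts => (C.1.card : ℝ)) (fun C => cellValue p C y) =
      atomLaw 𝒢 (fun _ : Fin n => 1) y := by
  have h1 := h.atomLaw (e := fun C : p.parts => (C.1.card : ℝ))
    (fun C => Nat.cast_pos.2 (Finset.card_pos.2 (p.nonempty_of_mem_parts C.2)))
    (fun C => cellValue p C y)
  have h2 := h.atomLaw (e := fun _ : Fin n => 1) (by simp) y
  rw [sum_card_smul_dirac_cellValue hy] at h1
  simp only [ENNReal.ofReal_one, one_smul] at h2
  exact h1.unique h2

/-- The Blackwell–MacQueen representation of a Beta-Gamma law. -/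
theorem hasLaw_beta_smul_add_cellAtoms [MeasurableEq 𝓨] {Ω : Type*} [MeasurableSpace Ω]
    (Pr : Measure Ω) [IsProbabilityMeasure Pr] (H : Measure 𝓨) [IsProbabilityMeasure H]
    {θ q : ℝ} (hθ : 0 < θ) (hq : 0 < q) {𝒢 : Measure (Measure 𝓨)}
    (h𝒢 : IsGammaLaw (ENNReal.ofReal θ • H) 𝒢) {n : ℕ} (hn : 0 < θ + n - q)
    {Y : Ω → Fin n → 𝓨} (hY : Measurable Y) (hYl : HasLaw Y (blackwellMacQueen θ H n) Pr)
    {U : Ω → ℝ} {M : Ω → Measure 𝓨} {G : Finset (Fin n) → Ω → ℝ}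
    (h : ∀ p : Finpartition (Finset.univ : Finset (Fin n)),
      Pr {ω | tiePartition (Y ω) = p} ≠ 0 →
      HasLaw
        (fun ω => (U ω, M ω, (fun C : p.parts => cellValue p C (Y ω)),
          fun C : p.parts => G C ω))
        ((betaMeasure q (θ + n - q)).prod (𝒢.prod
          (((Pr[|{ω | tiePartition (Y ω) = p}]).map
              fun ω => fun C : p.parts => cellValue p C (Y ω)).prod
            (Measure.pi fun C : p.parts => gammaMeasure (C.1.card : ℝ) 1))))
        (Pr[|{ω | tiePartition (Y ω) = p}])) :
    HasLaw
      (fun ω => ENNReal.ofReal (U ω) • M ω + ENNReal.ofReal (U ω) •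
        ∑ C : (tiePartition (Y ω)).parts,
          ENNReal.ofReal (G C ω) • Measure.dirac (cellValue (tiePartition (Y ω)) C (Y ω)))
      (betaGammaLaw θ (θ - q) 𝒢) Pr := by
  have : IsFiniteMeasure (ENNReal.ofReal θ • H) := Measure.smul_finite _ ENNReal.ofReal_ne_top
  have hp𝒢 := h𝒢.isProbabilityMeasure
  have := isProbabilityMeasureBeta hq hn
  have hSm := measurable_ofReal_smul_measure (𝓨 := 𝓨)
  set X : Ω → Measure 𝓨 := fun ω => ENNReal.ofReal (U ω) • M ω + ENNReal.ofReal (U ω) •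
        ∑ C : (tiePartition (Y ω)).parts,
          ENNReal.ofReal (G C ω) • Measure.dirac (cellValue (tiePartition (Y ω)) C (Y ω)) with hX
  -- The number of atoms depends on the partition, so measurability and integrals are handled
  -- separately on each of the finitely many events; null events carry no information and are
  -- discarded.
  let S : Finpartition (Finset.univ : Finset (Fin n)) → Set Ω :=
    fun p => {ω | tiePartition (Y ω) = p}
  have hS : ∀ p, MeasurableSet (S p) := fun p => hY (measurableSet_tiePartition_eq p)
  have hSU : ⋃ p, S p = Set.univ := Set.eq_univ_of_forall fun ω => Set.mem_iUnion.2 ⟨_, rfl⟩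
  have hSd : Pairwise (Function.onFun Disjoint S) := by
    intro p p' hne
    refine Set.disjoint_left.2 fun ω (h1 : tiePartition (Y ω) = p)
      (h2 : tiePartition (Y ω) = p') => hne (h1.symm.trans h2)
  have hm := measurable_atomLaw 𝒢 (e := fun _ : Fin n => 1) (by simp)
  have hcard : ∀ (p : Finpartition (Finset.univ : Finset (Fin n))) (C : p.parts),
      (0 : ℝ) < C.1.card := fun p C =>
    Nat.cast_pos.2 (Finset.card_pos.2 (p.nonempty_of_mem_parts C.2))
  let f : ∀ p : Finpartition (Finset.univ : Finset (Fin n)),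
      ℝ × Measure 𝓨 × (p.parts → 𝓨) × (p.parts → ℝ) → Measure 𝓨 := fun p x =>
    ENNReal.ofReal x.1 • (x.2.1 + ∑ C, ENNReal.ofReal (x.2.2.2 C) • Measure.dirac (x.2.2.1 C))
  have hf : ∀ p, Measurable (f p) := fun p =>
    hSm.comp (measurable_fst.prodMk (measurable_sum_smul_dirac
      (measurable_fst.comp measurable_snd)
      (measurable_snd.comp (measurable_snd.comp measurable_snd))
      (measurable_fst.comp (measurable_snd.comp measurable_snd))))
  have hXf : ∀ p, ∀ ω ∈ S p, X ω = f p (U ω, M ω, (fun C : p.parts => cellValue p C (Y ω)),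
      fun C : p.parts => G C ω) := by
    rintro p ω (rfl : tiePartition (Y ω) = p)
    simp only [hX, f, smul_add]
  have hrestrict : ∀ p, Pr (S p) ≠ 0 → Pr.restrict (S p) = Pr (S p) • Pr[|S p] := by
    intro p h0
    rw [ProbabilityTheory.cond, smul_smul, ENNReal.mul_inv_cancel h0 (measure_ne_top _ _), one_smul]
  have hXc : ∀ p, X =ᵐ[Pr[|S p]] fun ω => f p (U ω, M ω,
      (fun C : p.parts => cellValue p C (Y ω)), fun C : p.parts => G C ω) := fun p => by
    filter_upwards [ae_cond_mem (μ := Pr) (hS p)] with ω hω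
    exact hXf p ω hω
  have hXm : AEMeasurable X Pr := by
    rw [← Measure.restrict_univ (μ := Pr), ← hSU, aemeasurable_iUnion_iff]
    intro p
    by_cases h0 : Pr (S p) = 0
    · rw [Measure.restrict_eq_zero.2 h0]
      exact aemeasurable_zero_measure
    · rw [hrestrict p h0]
      exact (((hf p).comp_aemeasurable (h p h0).aemeasurable).congr (hXc p).symm).smul_measure _
  refine ⟨hXm, Measure.ext_of_lintegral _ fun F hF => ?_⟩
  rw [lintegral_map' hF.aemeasurable hXm]
  have hFu : ∀ u : ℝ, Measurable fun μ : Measure 𝓨 => F (ENNReal.ofReal u • μ) := fun u =>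
    hF.comp (measurable_const_smul_measure _)
  -- `Ψ p` uses one Gamma weight per cell, `Φ` one exponential weight per draw. As `Φ` no longer
  -- mentions `p`, the separate events can be reassembled.
  let Ψ : ∀ p : Finpartition (Finset.univ : Finset (Fin n)), (p.parts → 𝓨) → ℝ≥0∞ := fun p v =>
    ∫⁻ u, ∫⁻ μ, F (ENNReal.ofReal u • μ) ∂(atomLaw 𝒢 (fun C : p.parts => (C.1.card : ℝ)) v)
      ∂betaMeasure q (θ + n - q)
  let Φ : (Fin n → 𝓨) → ℝ≥0∞ := fun y =>
    ∫⁻ u, ∫⁻ μ, F (ENNReal.ofReal u • μ) ∂(atomLaw 𝒢 (fun _ : Fin n => 1) y)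
      ∂betaMeasure q (θ + n - q)
  have hjoint : Measurable fun x : (Fin n → 𝓨) × ℝ =>
      ∫⁻ μ, F (ENNReal.ofReal x.2 • μ) ∂(atomLaw 𝒢 (fun _ : Fin n => 1) x.1) := by
    simp_rw [fun x : (Fin n → 𝓨) × ℝ => lintegral_atomLaw 𝒢 (fun _ : Fin n => 1) x.1 (hFu x.2)]
    have : IsProbabilityMeasure (gammaMeasure 1 1) :=
      isProbabilityMeasure_gammaMeasure one_pos one_pos
    refine Measurable.lintegral_prod_right' (f := fun x : ((Fin n → 𝓨) × ℝ) ×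
      (Measure 𝓨 × (Fin n → ℝ)) => F (ENNReal.ofReal x.1.2 • (x.2.1 +
        ∑ i, ENNReal.ofReal (x.2.2 i) • Measure.dirac (x.1.1 i)))) (hF.comp ?_)
    exact hSm.comp ((measurable_snd.comp measurable_fst).prodMk (measurable_sum_smul_dirac
      (measurable_fst.comp measurable_snd) (measurable_snd.comp measurable_snd)
      (measurable_fst.comp measurable_fst)))
  have hΦ : Measurable Φ := Measurable.lintegral_prod_right' hjoint
  have hcell : ∀ p, ∫⁻ ω in S p, F (X ω) ∂Pr = ∫⁻ ω in S p, Φ (Y ω) ∂Pr := by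
    intro p
    by_cases h0 : Pr (S p) = 0
    · rw [Measure.restrict_eq_zero.2 h0]
      simp
    have hpr : ∀ C : p.parts, IsProbabilityMeasure (gammaMeasure (C.1.card : ℝ) 1) := fun C =>
      isProbabilityMeasure_gammaMeasure (hcard p C) one_pos
    have hΨ : Measurable (Ψ p) := by
      have : Measurable fun x : (p.parts → 𝓨) × ℝ => ∫⁻ μ, F (ENNReal.ofReal x.2 • μ)
          ∂(atomLaw 𝒢 (fun C : p.parts => (C.1.card : ℝ)) x.1) := by
        simp_rw [fun x : (p.parts → 𝓨) × ℝ =>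
          lintegral_atomLaw 𝒢 (fun C : p.parts => (C.1.card : ℝ)) x.1 (hFu x.2)]
        refine Measurable.lintegral_prod_right' (f := fun x : ((p.parts → 𝓨) × ℝ) ×
          (Measure 𝓨 × (p.parts → ℝ)) => F (ENNReal.ofReal x.1.2 • (x.2.1 +
            ∑ i, ENNReal.ofReal (x.2.2 i) • Measure.dirac (x.1.1 i)))) (hF.comp ?_)
        exact hSm.comp ((measurable_snd.comp measurable_fst).prodMk (measurable_sum_smul_dirac
          (measurable_fst.comp measurable_snd) (measurable_snd.comp measurable_snd)
          (measurable_fst.comp measurable_fst)))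
      exact Measurable.lintegral_prod_right' this
    have hcellm : Measurable fun ω => fun C : p.parts => cellValue p C (Y ω) :=
      (measurable_cellValue p).comp hY
    have hFf : Measurable fun x => F (f p x) := hF.comp (hf p)
    rw [hrestrict p h0, lintegral_smul_measure, lintegral_smul_measure]
    congr 1
    calc ∫⁻ ω, F (X ω) ∂Pr[|S p]
        = ∫⁻ ω, F (f p (U ω, M ω, (fun C : p.parts => cellValue p C (Y ω)),
            fun C : p.parts => G C ω)) ∂Pr[|S p] := by
          refine lintegral_congr_ae ?_
          filter_upwards [hXc p] with ω hω
          rw [hω]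
      _ = ∫⁻ v, Ψ p v ∂((Pr[|S p]).map fun ω => fun C : p.parts => cellValue p C (Y ω)) := by
          rw [(h p h0).lintegral_comp (f := fun x => F (f p x)) hFf.aemeasurable,
            lintegral_prod_four _ _ _ _ hFf]
          refine lintegral_congr fun v => lintegral_congr fun u => ?_
          rw [lintegral_atomLaw _ _ _ (hFu u)]
      _ = ∫⁻ ω, Ψ p (fun C : p.parts => cellValue p C (Y ω)) ∂Pr[|S p] :=
          lintegral_map hΨ hcellm
      _ = ∫⁻ ω, Φ (Y ω) ∂Pr[|S p] := by
          refine lintegral_congr_ae ?_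
          filter_upwards [ae_cond_mem (μ := Pr) (hS p)] with ω hω
          simp only [Ψ, Φ]
          -- Merging the atoms needs no information on the conditional law of the cell values, so
          -- `H` may have atoms here.
          rw [atomLaw_cellValue h𝒢 hω]
  have htotal : ∫⁻ ω, F (X ω) ∂Pr = ∫⁻ ω, Φ (Y ω) ∂Pr := by
    rw [← setLIntegral_univ, ← hSU, lintegral_iUnion hS hSd, tsum_congr hcell,
      ← lintegral_iUnion hS hSd, hSU, setLIntegral_univ]
  have hsf : SFinite (blackwellMacQueen θ H n) := by
    unfold blackwellMacQueen
    infer_instance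
  rw [htotal, hYl.lintegral_comp hΦ.aemeasurable,
    ← lintegral_beta_blackwellMacQueen H hθ hq h𝒢 n hn hF]
  exact lintegral_lintegral_swap
    (f := fun y u => ∫⁻ μ, F (ENNReal.ofReal u • μ) ∂(atomLaw 𝒢 (fun _ : Fin n => 1) y))
    hjoint.aemeasurable

end PartitionRepresentation

/-! ### The theorem, assembled. -/

theorem theorem2p2 {𝓨 Ω Ω' : Type*} [MeasurableSpace 𝓨] [MeasurableEq 𝓨]
    [MeasurableSpace Ω] [MeasurableSpace Ω']
    (Pr : Measure Ω) [IsProbabilityMeasure Pr] (Pr' : Measure Ω') [IsProbabilityMeasure Pr']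
    (H : Measure 𝓨) [IsProbabilityMeasure H] (θ q : ℝ) (hθ : 0 < θ) (hq : 0 < q)
    -- the law of the Gamma process with shape `θH`
    (𝒢 : Measure (Measure 𝓨)) (h𝒢 : IsGammaLaw (ENNReal.ofReal θ • H) 𝒢) :
    -- (i)
    (∀ n : ℕ, 0 < θ + n - q →
      ∀ Y : Ω → Fin n → 𝓨, Measurable Y → HasLaw Y (blackwellMacQueen θ H n) Pr →
        -- given the partition `p`, the elements `U`, `M`, `(Y_C^*)_C` and the `G_C` are independent,
        -- with `U ~ Beta(q, θ + n - q)`, `M` a Gamma process and `G_C ~ Gamma(|C|, 1)`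
        (∀ (U : Ω → ℝ) (M : Ω → Measure 𝓨) (G : Finset (Fin n) → Ω → ℝ),
          (∀ p : Finpartition (Finset.univ : Finset (Fin n)),
            Pr {ω | tiePartition (Y ω) = p} ≠ 0 →
            HasLaw
              (fun ω => (U ω, M ω, (fun C : p.parts => cellValue p C (Y ω)),
                fun C : p.parts => G C ω))
              ((betaMeasure q (θ + n - q)).prod (𝒢.prod
                (((Pr[|{ω | tiePartition (Y ω) = p}]).map
                    fun ω => fun C : p.parts => cellValue p C (Y ω)).prod
                  (Measure.pi fun C : p.parts => gammaMeasure (C.1.card : ℝ) 1))))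
              (Pr[|{ω | tiePartition (Y ω) = p}])) →
          HasLaw
            (fun ω => ENNReal.ofReal (U ω) • M ω + ENNReal.ofReal (U ω) •
              ∑ C : (tiePartition (Y ω)).parts,
                ENNReal.ofReal (G C ω) • Measure.dirac (cellValue (tiePartition (Y ω)) C (Y ω)))
            (betaGammaLaw θ (θ - q) 𝒢) Pr) ∧
        -- if `H` is nonatomic, `p` has the Ewens distribution and, given `p`, the `Y_C^*` are
        -- i.i.d. with law `H`
        (NullSingletonClass H → ∀ p : Finpartition (Finset.univ : Finset (Fin n)),
          Pr {ω | tiePartition (Y ω) = p} = ENNReal.ofReal (ewensWeight θ p) ∧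
          HasLaw (fun ω => fun C : p.parts => cellValue p C (Y ω))
            (Measure.pi fun _ : p.parts => H) (Pr[|{ω | tiePartition (Y ω) = p}]))) ∧
    -- (ii), with `U`, `M`, `T`, `Y` mutually independent
    (∀ (U : Ω → ℝ) (M : Ω → Measure 𝓨) (T : Ω → ℝ) (Y : Ω → 𝓨),
      HasLaw (fun ω => (U ω, M ω, T ω, Y ω))
        ((betaMeasure 1 θ).prod (𝒢.prod ((gammaMeasure 1 1).prod H))) Pr →
      HasLaw
        (fun ω => ENNReal.ofReal (U ω) • M ω +
          ENNReal.ofReal (U ω) • ENNReal.ofReal (T ω) • Measure.dirac (Y ω))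
        (betaGammaLaw θ (θ - 1) 𝒢) Pr) ∧
    (∀ (U : Ω → ℝ) (M : Ω → Measure 𝓨) (T : Ω → ℝ) (Y : Ω → 𝓨),
      HasLaw (fun ω => (U ω, M ω, T ω, Y ω))
        ((betaMeasure θ 1).prod (𝒢.prod ((gammaMeasure 1 1).prod H))) Pr →
      HasLaw
        (fun ω => ENNReal.ofReal (U ω) • M ω +
          ENNReal.ofReal (U ω) • ENNReal.ofReal (T ω) • Measure.dirac (Y ω))
        𝒢 Pr) ∧
    -- (iii), with `T` and `P`, `S` and `B`, `T` and `M` independent, `𝒟` being the law of the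
    -- Dirichlet process with shape `θH`
    (∀ 𝒟 : Measure (Measure 𝓨), IsDirichletLaw (ENNReal.ofReal θ • H) 𝒟 →
      ∀ (T : Ω → ℝ) (P : Ω → Measure 𝓨),
      HasLaw (fun ω => (T ω, P ω)) ((gammaMeasure q 1).prod 𝒟) Pr →
      HasLaw (fun ω => ENNReal.ofReal (T ω) • P ω) (betaGammaLaw θ (θ - q) 𝒢) Pr) ∧
    (∀ (S : Ω → ℝ) (B : Ω → Measure 𝓨) (T : Ω' → ℝ) (M : Ω' → Measure 𝓨),
      HasLaw (fun ω => (S ω, B ω)) ((gammaMeasure θ 1).prod (betaGammaLaw θ (θ - q) 𝒢)) Pr →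
      HasLaw (fun ω => (T ω, M ω)) ((gammaMeasure q 1).prod 𝒢) Pr' →
      IdentDistrib (fun ω => ENNReal.ofReal (S ω) • B ω)
        (fun ω => ENNReal.ofReal (T ω) • M ω) Pr Pr') := by
  refine ⟨fun n hn Y hY hYl => ⟨fun U M G h => ?_, fun _ p => ?_⟩, fun U M T Y h => ?_,
    fun U M T Y h => ?_, fun 𝒟 h𝒟 T P hTP => ?_, fun S B T M hSB hTM => ?_⟩
  · exact hasLaw_beta_smul_add_cellAtoms Pr H hθ hq h𝒢 hn hY hYl h
  · exact tiePartition_law Pr H hθ hY hYl p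
  · exact hasLaw_beta_smul_add_atom Pr H hθ one_pos (by simpa using hθ) h𝒢
      (by rwa [add_sub_cancel_right])
  -- For `q = θ` the exponent `θ - q` vanishes, so the Beta-Gamma law is the Gamma law itself, and
  -- the second Beta parameter is `θ + 1 - θ = 1`.
  · have key := hasLaw_beta_smul_add_atom (q := θ) Pr H hθ hθ (by simp) h𝒢 (U := U) (M := M)
      (T := T) (Y := Y) (by rwa [add_sub_cancel_left])
    rwa [sub_self, betaGammaLaw_zero 𝒢 hθ] at key
  · exact hasLaw_gamma_smul_dirichlet Pr H hθ hq h𝒢 h𝒟 hTP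
  · have hS := measurable_ofReal_smul_measure (𝓨 := 𝓨)
    -- With one of the two shapes equal to `θ`, the Beta-Gamma law on the right has `d = 0` and is
    -- the Gamma law.
    have key := map_gamma_smul_betaGammaLaw_comm H hθ hθ hq h𝒢
    rw [sub_self, betaGammaLaw_zero 𝒢 hθ] at key
    refine ⟨hS.comp_aemeasurable hSB.aemeasurable, hS.comp_aemeasurable hTM.aemeasurable, ?_⟩
    have hB := HasLaw.fun_comp (HasLaw.mk hS.aemeasurable rfl) hSB
    have hM := HasLaw.fun_comp (HasLaw.mk hS.aemeasurable rfl) hTM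
    rw [hB.map_eq, hM.map_eq, key]
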